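/- Let $n\ge 1$ and let $M^{n\times n}_+$ be the set of real $n\times n$ matrices $A$ with $\det A>0$. Let $p\in(n,\infty)$. For bounded domains $\Omega_1,\Omega_2\subset\mathbb R^n$, an orientation-preserving invertible map $y$ with $y(\Omega_1)=\Omega_2$ means a homeomorphism $y$ of $\Omega_1$ onto $\Omega_2$ such that $y\in W^{1,p}(\Omega_1,\mathbb R^n)$, $y^{-1}\in W^{1,p}(\Omega_2,\mathbb R^n)$ and $\det Dy(x)>0$ for almost every $x\in\Omega_1$, where $Dy$ is the distributional gradient. Let $\Psi:M^{n\times n}_+\to\mathbb R$ be a function. Then the following are equivalent. (i) For every bounded Lipschitz domain $\Omega_1\subset\mathbb R^n$, every $M\in M^{n\times n}_+$ and every orientation-preserving invertible $y$ with $y(\Omega_1)=M\Omega_1$, $$\frac1{|\Omega_1|}\int_{\Omega_1}\Psi(Dy(x))\,dx\ \ge\ \Psi(M),$$ where the integral takes values in $[-\infty,\infty]$ (the integral of the positive part of $\Psi(Dy)$ minus that of its negative part, with $\infty-\infty=-\infty$; for $\Psi\ge 0$ it is the usual integral in $[0,\infty]$; lower integrals are taken if $\Psi(Dy)$ is not measurable).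 (ii) There is a convex function $H:(0,\infty)\to\mathbb R$ such that $\Psi(A)=H(\det A)$ for all $A\in M^{n\times n}_+$. -/

import Mathlib

open MeasureTheory Set
open scoped ContDiff

/-- A *bounded Lipschitz domain* in `ℝⁿ`: a nonempty, bounded, connected open set such that, near
each of its boundary points, it is the part of space lying above the graph of a Lipschitz function,
in the direction of some unit vector `e`. Here `x - ⟪e, x⟫ e` is the component of `x` orthogonal
to `e`, and `⟪e, x⟫` its height. -/
structure IsBoundedLipschitzDomain {n : ℕ} (Ω : Set (EuclideanSpace ℝ (Fin n))) : Prop where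
  isOpen : IsOpen Ω
  isConnected : IsConnected Ω
  isBounded : Bornology.IsBounded Ω
  lipschitz_boundary : ∀ x₀ ∈ frontier Ω,
    ∃ (e : EuclideanSpace ℝ (Fin n)) (γ : EuclideanSpace ℝ (Fin n) → ℝ) (K : NNReal) (r : ℝ),
      ‖e‖ = 1 ∧ LipschitzWith K γ ∧ 0 < r ∧
      ∀ x ∈ Metric.ball x₀ r, (x ∈ Ω ↔ γ (x - inner ℝ e x • e) < inner ℝ e x)

/-- `y` belongs to the Sobolev space `W^{1,p}(Ω, ℝⁿ)`, and `F` is (a representative of) its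
distributional gradient `Dy`, with entries `F x i j = ∂y_i/∂x_j (x)`. Only the values of `y` and
`F` on `Ω` matter. -/
structure HasSobolevGradient {n : ℕ} (p : ℝ) (Ω : Set (EuclideanSpace ℝ (Fin n)))
    (y : EuclideanSpace ℝ (Fin n) → EuclideanSpace ℝ (Fin n))
    (F : EuclideanSpace ℝ (Fin n) → Matrix (Fin n) (Fin n) ℝ) : Prop where
  memLp : MemLp y (ENNReal.ofReal p) (volume.restrict Ω)
  memLp_gradient : ∀ i j, MemLp (fun x => F x i j) (ENNReal.ofReal p) (volume.restrict Ω)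
  integral_eq : ∀ φ : EuclideanSpace ℝ (Fin n) → ℝ,
    ContDiff ℝ ∞ φ → HasCompactSupport φ → tsupport φ ⊆ Ω → ∀ i j,
      ∫ x in Ω, y x i * fderiv ℝ φ x (EuclideanSpace.single j 1) = - ∫ x in Ω, F x i j * φ x

/-- `y` is an orientation-preserving invertible map of `Ω₁` onto `Ω₂` with distributional gradient
`F`: `y` is a homeomorphism of `Ω₁` onto `Ω₂`, both `y` and its inverse are of class `W^{1,p}`, and
`det Dy > 0` almost everywhere in `Ω₁`. -/
structure IsOrientationPreservingInvertible {n : ℕ} (p : ℝ)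
    (Ω₁ Ω₂ : Set (EuclideanSpace ℝ (Fin n)))
    (y : EuclideanSpace ℝ (Fin n) → EuclideanSpace ℝ (Fin n))
    (F : EuclideanSpace ℝ (Fin n) → Matrix (Fin n) (Fin n) ℝ) : Prop where
  continuousOn : ContinuousOn y Ω₁
  bijOn : BijOn y Ω₁ Ω₂
  sobolev : HasSobolevGradient p Ω₁ y F
  inverse : ∃ z G, InvOn z y Ω₁ Ω₂ ∧ ContinuousOn z Ω₂ ∧ HasSobolevGradient p Ω₂ z G
  det_pos : ∀ᵐ x ∂(volume.restrict Ω₁), 0 < (F x).det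

/-- The average `⨍_Ω f dx` of a real function as an extended real number, the average of the
positive part minus the average of the negative part. For `f ≥ 0` it lies in `[0, ∞]`. In `EReal`,
`⊤ - ⊤ = ⊥`, so a lower bound on `extAverage Ω f` by a real number says in particular that the
negative part of `f` has a finite integral. -/
noncomputable def extAverage {n : ℕ} (Ω : Set (EuclideanSpace ℝ (Fin n)))
    (f : EuclideanSpace ℝ (Fin n) → ℝ) : EReal :=
  ((⨍⁻ x in Ω, ENNReal.ofReal (f x) ∂volume : ENNReal) : EReal) -
    ((⨍⁻ x in Ω, ENNReal.ofReal (-f x) ∂volume : ENNReal) : EReal)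

/-! A function of the determinant turns the inequality into Jensen's. If `y` maps `Ω`
homeomorphically onto `MΩ` with positive Jacobian and the change of variables formula holds, then ∫
det Dy = |MΩ| = det M · |Ω|. So det Dy has average det M, and integrating a supporting line of `H`
at det M gives the bound (`IsOrientationPreservingInvertible.le_extAverage`).

The analytic work is the change of variables formula for such `y`,
`HasSobolevGradient.lintegral_abs_det_eq`. Since p > n, Morrey's inequality bounds the oscillation
of a component on a ball by the L^p norm of its gradient there. It has two consequences: at L^p
Lebesgue points of the gradient `y` is classically differentiable with derivative Dy, and `y` sends
null sets to null sets. The area formula for differentiable maps then applies off a null set whose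
image is null.

Conversely, suppose that the inequality always holds. If `S` has finite order and determinant one,
some norm is `S`-invariant, and its unit ball `Ω` satisfies SΩ = Ω. The linear map `B * S` then
competes with `B`, so Ψ(B) ≤ Ψ(BS). The same argument for the inverse of `S` gives equality.
Matrices of finite order generate SL(n, ℝ): the group relations of SL(2, ℤ), conjugated by a
diagonal matrix, write every transvection and every two-entry diagonal matrix of determinant one as
a product of such matrices. Hence Ψ depends on the determinant only. For convexity, the unit cube is
mapped onto a box by stretching one coordinate with slope `a` on a fraction `c` of the cube and
slope `b` on the rest; the inequality for this map is exactly the convexity inequality of d ↦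
Ψ(diag(d, 1, …, 1)). -/

/-- `f` is the weak gradient on `Ω` of the scalar function `u`. -/
def HasWeakGradient {n : ℕ} (Ω : Set (EuclideanSpace ℝ (Fin n)))
    (u : EuclideanSpace ℝ (Fin n) → ℝ) (f : Fin n → EuclideanSpace ℝ (Fin n) → ℝ) : Prop :=
  ∀ φ : EuclideanSpace ℝ (Fin n) → ℝ,
    ContDiff ℝ ∞ φ → HasCompactSupport φ → tsupport φ ⊆ Ω → ∀ j,
      ∫ x in Ω, u x * fderiv ℝ φ x (EuclideanSpace.single j 1) = - ∫ x in Ω, f j x * φ x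

/-! ### Morrey's inequality, by averages over balls shrinking to a point -/

namespace Morrey

variable {n : ℕ} {φ : EuclideanSpace ℝ (Fin n) → ℝ}

/-- The kernel `φ` rescaled to size `ρ`, centred at `x + ρ v`. -/
noncomputable def kernel (φ : EuclideanSpace ℝ (Fin n) → ℝ) (x v : EuclideanSpace ℝ (Fin n))
    (ρ : ℝ) (z : EuclideanSpace ℝ (Fin n)) : ℝ :=
  ρ⁻¹ ^ n * φ (ρ⁻¹ • (z - x) - v)

/-- The derivative of `kernel` in `ρ`. -/
noncomputable def kernelDeriv (φ : EuclideanSpace ℝ (Fin n) → ℝ) (x v : EuclideanSpace ℝ (Fin n))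
    (ρ : ℝ) (z : EuclideanSpace ℝ (Fin n)) : ℝ :=
  -(n * ρ⁻¹ ^ (n + 1) * φ (ρ⁻¹ • (z - x) - v)
    + ρ⁻¹ ^ (n + 2) * fderiv ℝ φ (ρ⁻¹ • (z - x) - v) (z - x))

/-- The vector field whose divergence is minus the derivative of `kernel` in `ρ`. -/
noncomputable def field (φ : EuclideanSpace ℝ (Fin n) → ℝ) (x v : EuclideanSpace ℝ (Fin n))
    (ρ : ℝ) (j : Fin n) (z : EuclideanSpace ℝ (Fin n)) : ℝ :=
  ρ⁻¹ ^ (n + 1) * φ (ρ⁻¹ • (z - x) - v) * (z j - x j)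

theorem norm_sub_le_of_mem {x v z : EuclideanSpace ℝ (Fin n)} {ρ : ℝ} (hρ : 0 < ρ)
    (hv : ‖v‖ ≤ 1) (hz : ‖ρ⁻¹ • (z - x) - v‖ ≤ 1) : ‖z - x‖ ≤ 2 * ρ := by
  have h : ‖ρ⁻¹ • (z - x)‖ ≤ 2 := by
    calc ‖ρ⁻¹ • (z - x)‖ = ‖(ρ⁻¹ • (z - x) - v) + v‖ := by simp
      _ ≤ _ := (norm_add_le _ _).trans (by linarith)
  rw [norm_smul, norm_inv, Real.norm_of_nonneg hρ.le, inv_mul_le_iff₀ hρ] at h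
  linarith

theorem mem_closedBall_iff {x v z : EuclideanSpace ℝ (Fin n)} {ρ : ℝ} (hρ : 0 < ρ) :
    z ∈ Metric.closedBall (x + ρ • v) ρ ↔ ‖ρ⁻¹ • (z - x) - v‖ ≤ 1 := by
  have : ρ⁻¹ • (z - x) - v = ρ⁻¹ • (z - (x + ρ • v)) := by
    rw [← sub_sub, smul_sub _ (z - x), smul_smul, inv_mul_cancel₀ hρ.ne', one_smul]
  rw [this, norm_smul, norm_inv, Real.norm_of_nonneg hρ.le, inv_mul_le_iff₀ hρ, mul_one,
    mem_closedBall_iff_norm]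

theorem hasDerivAt_kernel (hφ : ContDiff ℝ ∞ φ) (x v z : EuclideanSpace ℝ (Fin n)) {ρ : ℝ}
    (hρ : 0 < ρ) : HasDerivAt (fun ρ => kernel φ x v ρ z) (kernelDeriv φ x v ρ z) ρ := by
  have h1 : HasDerivAt (fun ρ : ℝ => ρ⁻¹) (-(ρ ^ 2)⁻¹) ρ := hasDerivAt_inv hρ.ne'
  have h2 : HasDerivAt (fun ρ : ℝ => ρ⁻¹ • (z - x) - v) ((-(ρ ^ 2)⁻¹) • (z - x)) ρ :=
    (h1.smul_const (z - x)).sub_const v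
  have h3 := ((hφ.differentiable (by simp)) (ρ⁻¹ • (z - x) - v)).hasFDerivAt.comp_hasDerivAt ρ h2
  refine ((h1.pow n).mul h3).congr_deriv ?_
  simp only [kernelDeriv, map_smul, smul_eq_mul, Function.comp, Pi.pow_apply]
  rcases n with _ | m
  · simp
  · simp only [Nat.add_sub_cancel, inv_pow]
    field_simp
    ring

theorem contDiff_field (hφ : ContDiff ℝ ∞ φ) (x v : EuclideanSpace ℝ (Fin n)) (ρ : ℝ)
    (j : Fin n) : ContDiff ℝ ∞ (field φ x v ρ j) := by
  unfold field
  have h : ContDiff ℝ ∞ fun z : EuclideanSpace ℝ (Fin n) => z j :=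
    (EuclideanSpace.proj (𝕜 := ℝ) j).contDiff
  have h2 : ContDiff ℝ ∞ fun z : EuclideanSpace ℝ (Fin n) => ρ⁻¹ • (z - x) - v := by fun_prop
  exact (contDiff_const.mul (hφ.comp h2)).mul (h.sub contDiff_const)

theorem fderiv_field (hφ : ContDiff ℝ ∞ φ) (x v z : EuclideanSpace ℝ (Fin n)) {ρ : ℝ}
    (j : Fin n) : fderiv ℝ (field φ x v ρ j) z (EuclideanSpace.single j 1) =
      ρ⁻¹ ^ (n + 1) * φ (ρ⁻¹ • (z - x) - v) + ρ⁻¹ ^ (n + 2) *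
        fderiv ℝ φ (ρ⁻¹ • (z - x) - v) ((z j - x j) • EuclideanSpace.single j 1) := by
  have h : HasFDerivAt (fun z : EuclideanSpace ℝ (Fin n) => z j - x j)
      (EuclideanSpace.proj (𝕜 := ℝ) j) z :=
    (EuclideanSpace.proj (𝕜 := ℝ) j).hasFDerivAt.sub_const _
  have h2 : HasFDerivAt (fun z : EuclideanSpace ℝ (Fin n) => ρ⁻¹ • (z - x) - v)
      (ρ⁻¹ • ContinuousLinearMap.id ℝ (EuclideanSpace ℝ (Fin n))) z :=
    (((hasFDerivAt_id z).sub_const x).const_smul ρ⁻¹).sub_const v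
  have h3 := ((hφ.differentiable (by simp)) (ρ⁻¹ • (z - x) - v)).hasFDerivAt.comp z h2
  have h4 := (h3.const_mul (ρ⁻¹ ^ (n + 1))).mul h
  have h5 : fderiv ℝ (field φ x v ρ j) z = _ := HasFDerivAt.fderiv h4
  rw [h5]
  simp
  ring

/-- The mass of the kernel does not depend on ρ, so its ρ-derivative is a divergence. Under the
integral this moves the derivative onto `u` and leaves only its weak gradient. -/
theorem kernelDeriv_eq (hφ : ContDiff ℝ ∞ φ) (x v z : EuclideanSpace ℝ (Fin n)) (ρ : ℝ) :
    kernelDeriv φ x v ρ z =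
      -∑ j, fderiv ℝ (field φ x v ρ j) z (EuclideanSpace.single j 1) := by
  simp_rw [fderiv_field hφ]
  rw [Finset.sum_add_distrib, ← Finset.mul_sum, ← Finset.mul_sum, ← map_sum]
  have : ∑ j, (z j - x j) • EuclideanSpace.single j (1 : ℝ) = z - x := by
    ext i
    simp [Finset.sum_apply, Pi.single_apply]
  rw [this]
  simp [kernelDeriv]
  ring

theorem tsupport_field (h1 : ∀ w, 1 < ‖w‖ → φ w = 0)
    (x v : EuclideanSpace ℝ (Fin n)) {ρ : ℝ} (hρ : 0 < ρ) (j : Fin n) :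
    tsupport (field φ x v ρ j) ⊆ Metric.closedBall (x + ρ • v) ρ := by
  refine closure_minimal (fun z hz => ?_) Metric.isClosed_closedBall
  rw [mem_closedBall_iff hρ]
  by_contra hc
  exact hz (by simp [field, h1 _ (not_le.1 hc)])

theorem abs_field_le {B : ℝ} (hB : ∀ w, |φ w| ≤ B) (h1 : ∀ w, 1 < ‖w‖ → φ w = 0)
    {x v : EuclideanSpace ℝ (Fin n)} (hv : ‖v‖ ≤ 1) {ρ : ℝ} (hρ : 0 < ρ) (j : Fin n)
    (z : EuclideanSpace ℝ (Fin n)) : |field φ x v ρ j z| ≤ 2 * B * ρ⁻¹ ^ n := by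
  have hB0 : 0 ≤ B := (abs_nonneg _).trans (hB 0)
  by_cases hz : ‖ρ⁻¹ • (z - x) - v‖ ≤ 1
  · have h2 := norm_sub_le_of_mem hρ hv hz
    have h3 : |z j - x j| ≤ 2 * ρ := (PiLp.norm_apply_le (z - x) j).trans h2
    rw [field, abs_mul, abs_mul, abs_of_nonneg (by positivity : 0 ≤ ρ⁻¹ ^ (n + 1))]
    calc _ ≤ ρ⁻¹ ^ (n + 1) * B * (2 * ρ) := by gcongr; exact hB _
      _ = _ := by rw [pow_succ]; field_simp
  · simp only [field, h1 _ (not_le.1 hz), mul_zero, zero_mul, abs_zero]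
    positivity

theorem abs_kernelDeriv_le {B D : ℝ} (hB : ∀ w, |φ w| ≤ B) (hD : ∀ w, ‖fderiv ℝ φ w‖ ≤ D)
    (h1 : ∀ w, 1 < ‖w‖ → φ w = 0) (h2 : ∀ w, 1 < ‖w‖ → fderiv ℝ φ w = 0)
    {x v : EuclideanSpace ℝ (Fin n)} (hv : ‖v‖ ≤ 1) {ρ ρ₀ : ℝ} (hρ₀ : 0 < ρ₀) (hρ : ρ₀ ≤ ρ)
    (z : EuclideanSpace ℝ (Fin n)) :
    |kernelDeriv φ x v ρ z| ≤ (n * B + 2 * D) * ρ₀⁻¹ ^ (n + 1) := by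
  have hB0 : 0 ≤ B := (abs_nonneg _).trans (hB 0)
  have hD0 : 0 ≤ D := (norm_nonneg _).trans (hD 0)
  have hρ' : 0 < ρ := hρ₀.trans_le hρ
  by_cases hz : ‖ρ⁻¹ • (z - x) - v‖ ≤ 1
  · have h3 := norm_sub_le_of_mem hρ' hv hz
    have h4 : |fderiv ℝ φ (ρ⁻¹ • (z - x) - v) (z - x)| ≤ D * (2 * ρ) :=
      (ContinuousLinearMap.le_opNorm _ _).trans
        (mul_le_mul (hD _) h3 (norm_nonneg _) hD0)
    rw [kernelDeriv, abs_neg]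
    calc _ ≤ n * ρ⁻¹ ^ (n + 1) * B + ρ⁻¹ ^ (n + 2) * (D * (2 * ρ)) := by
          refine (abs_add_le _ _).trans (add_le_add ?_ ?_)
          · rw [abs_mul, abs_of_nonneg (by positivity)]
            gcongr
            exact hB _
          · rw [abs_mul, abs_of_nonneg (by positivity)]
            gcongr
      _ = (n * B + 2 * D) * ρ⁻¹ ^ (n + 1) := by rw [pow_succ _ (n + 1)]; field_simp
      _ ≤ _ := by gcongr
  · simp only [kernelDeriv, h1 _ (not_le.1 hz), h2 _ (not_le.1 hz), mul_zero,
      zero_apply, add_zero, neg_zero, abs_zero]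
    positivity

/-- A smooth nonnegative function of integral one supported in the unit ball, with bounds for it
and its derivative. -/
structure IsMollifier (φ : EuclideanSpace ℝ (Fin n) → ℝ) (B D : ℝ) : Prop where
  contDiff : ContDiff ℝ ∞ φ
  nonneg : ∀ w, 0 ≤ φ w
  eq_zero : ∀ w, 1 < ‖w‖ → φ w = 0
  fderiv_eq_zero : ∀ w, 1 < ‖w‖ → fderiv ℝ φ w = 0
  abs_le : ∀ w, |φ w| ≤ B
  norm_fderiv_le : ∀ w, ‖fderiv ℝ φ w‖ ≤ D
  integral_eq_one : ∫ w, φ w = 1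

theorem exists_isMollifier (n : ℕ) :
    ∃ (φ : EuclideanSpace ℝ (Fin n) → ℝ) (B D : ℝ), IsMollifier φ B D := by
  let b : ContDiffBump (0 : EuclideanSpace ℝ (Fin n)) := ⟨1 / 2, 1, by norm_num, by norm_num⟩
  have hc : ContDiff ℝ ∞ (b.normed volume) := b.contDiff_normed
  have hs : HasCompactSupport (b.normed volume) := b.hasCompactSupport_normed
  obtain ⟨B, hB⟩ := hs.exists_bound_of_continuous hc.continuous
  obtain ⟨D, hD⟩ := (hs.fderiv ℝ).exists_bound_of_continuous
    (hc.continuous_fderiv (by simp))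
  have hz : ∀ w : EuclideanSpace ℝ (Fin n), 1 < ‖w‖ → w ∉ tsupport (b.normed volume) := by
    intro w hw
    rw [b.tsupport_normed_eq, mem_closedBall_zero_iff]
    exact not_le.2 hw
  exact ⟨b.normed volume, B, D, hc, fun w => b.nonneg_normed w,
    fun w hw => image_eq_zero_of_notMem_tsupport (hz w hw),
    fun w hw => Function.notMem_support.1 fun h => hz w hw (support_fderiv_subset ℝ h),
    hB, hD, b.integral_normed⟩

variable {B D : ℝ}

theorem integral_kernel (hφ : IsMollifier φ B D) (x v : EuclideanSpace ℝ (Fin n)) {ρ : ℝ}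
    (hρ : 0 < ρ) : ∫ z, kernel φ x v ρ z = 1 := by
  unfold kernel
  rw [integral_const_mul, integral_sub_right_eq_self (fun z => φ (ρ⁻¹ • z - v)) x,
    Measure.integral_comp_inv_smul_of_nonneg volume (fun z => φ (z - v)) hρ.le,
    integral_sub_right_eq_self (fun z => φ z) v, hφ.integral_eq_one]
  simp [hρ.ne']

theorem continuous_kernel (hφ : IsMollifier φ B D) (x v : EuclideanSpace ℝ (Fin n)) (ρ : ℝ) :
    Continuous (kernel φ x v ρ) := by
  have := hφ.contDiff.continuous
  unfold kernel
  fun_prop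

theorem continuous_kernelDeriv (hφ : IsMollifier φ B D) (x v : EuclideanSpace ℝ (Fin n))
    (ρ : ℝ) : Continuous (kernelDeriv φ x v ρ) := by
  have := hφ.contDiff.continuous
  have h2 := hφ.contDiff.continuous_fderiv (by simp)
  unfold kernelDeriv
  fun_prop

theorem kernel_nonneg (hφ : IsMollifier φ B D) (x v : EuclideanSpace ℝ (Fin n)) {ρ : ℝ}
    (hρ : 0 < ρ) (z) : 0 ≤ kernel φ x v ρ z :=
  mul_nonneg (by positivity) (hφ.nonneg _)

theorem kernel_eq_zero (hφ : IsMollifier φ B D) {x v z : EuclideanSpace ℝ (Fin n)} {ρ : ℝ}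
    (hρ : 0 < ρ) (hz : z ∉ Metric.closedBall (x + ρ • v) ρ) : kernel φ x v ρ z = 0 := by
  rw [mem_closedBall_iff hρ, not_le] at hz
  simp [kernel, hφ.eq_zero _ hz]

theorem abs_kernel_le (hφ : IsMollifier φ B D) (x v : EuclideanSpace ℝ (Fin n)) {ρ : ℝ}
    (hρ : 0 < ρ) (z) : |kernel φ x v ρ z| ≤ ρ⁻¹ ^ n * B := by
  rw [kernel, abs_mul, abs_of_nonneg (by positivity)]
  gcongr
  exact hφ.abs_le _

/-- Differentiation under the integral gives `kernelDeriv`, a divergence of compactly supported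
smooth fields; the components of `field` then serve as test functions in the definition of the weak
gradient. -/
theorem hasDerivAt_integral_kernel (hφ : IsMollifier φ B D)
    {Ω : Set (EuclideanSpace ℝ (Fin n))} {u : EuclideanSpace ℝ (Fin n) → ℝ}
    {f : Fin n → EuclideanSpace ℝ (Fin n) → ℝ} (hu : IntegrableOn u Ω)
    (hw : HasWeakGradient Ω u f)
    {x v : EuclideanSpace ℝ (Fin n)} (hv : ‖v‖ ≤ 1) {ρ : ℝ} (hρ : 0 < ρ)
    (hΩ : Metric.closedBall (x + ρ • v) ρ ⊆ Ω) :
    HasDerivAt (fun ρ => ∫ z in Ω, kernel φ x v ρ z * u z)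
      (∑ j, ∫ z in Ω, f j z * field φ x v ρ j z) ρ := by
  -- Keeping the parameter above ρ/2 bounds `kernelDeriv` uniformly, so a multiple of |u| dominates.
  have h := (hasDerivAt_integral_of_dominated_loc_of_deriv_le (μ := volume.restrict Ω)
    (F := fun ρ z => kernel φ x v ρ z * u z) (F' := fun ρ z => kernelDeriv φ x v ρ z * u z)
    (bound := fun z => (n * B + 2 * D) * (ρ / 2)⁻¹ ^ (n + 1) * |u z|)
    (Ioi_mem_nhds (half_lt_self hρ))
    (Filter.Eventually.of_forall fun s =>
      (continuous_kernel hφ x v s).aestronglyMeasurable.mul hu.aestronglyMeasurable)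
    (hu.bdd_mul (c := ρ⁻¹ ^ n * B) (continuous_kernel hφ x v ρ).aestronglyMeasurable
      (Filter.Eventually.of_forall fun z => abs_kernel_le hφ x v hρ z))
    ((continuous_kernelDeriv hφ x v ρ).aestronglyMeasurable.mul hu.aestronglyMeasurable)
    (Filter.Eventually.of_forall fun z s hs => by
      rw [norm_mul]
      refine mul_le_mul_of_nonneg_right ?_ (norm_nonneg _)
      exact abs_kernelDeriv_le hφ.abs_le hφ.norm_fderiv_le hφ.eq_zero hφ.fderiv_eq_zero hv
        (half_pos hρ) (mem_Ioi.1 hs).le z)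
    (hu.abs.const_mul _)
    (Filter.Eventually.of_forall fun z s hs =>
      (hasDerivAt_kernel hφ.contDiff x v z ((half_pos hρ).trans hs)).mul_const (u z))).2
  refine h.congr_deriv ?_
  have hc : ∀ j, HasCompactSupport (field φ x v ρ j) := fun j =>
    HasCompactSupport.intro (isCompact_closedBall (x + ρ • v) ρ) fun z hz => by
      by_contra h0
      exact hz (tsupport_field hφ.eq_zero x v hρ j (subset_tsupport _ h0))
  have hd : ∀ j, Continuous fun z =>
      fderiv ℝ (field φ x v ρ j) z (EuclideanSpace.single j 1) := fun j =>
    ((contDiff_field hφ.contDiff x v ρ j).continuous_fderiv (by simp)).clm_apply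
      continuous_const
  have hi : ∀ j, IntegrableOn (fun z => u z *
      fderiv ℝ (field φ x v ρ j) z (EuclideanSpace.single j 1)) Ω := fun j => by
    obtain ⟨K, hK⟩ := ((hc j).fderiv_apply ℝ (EuclideanSpace.single j
      (1 : ℝ))).exists_bound_of_continuous (hd j)
    exact hu.mul_bdd (c := K) (hd j).aestronglyMeasurable (Filter.Eventually.of_forall hK)
  calc ∫ z in Ω, kernelDeriv φ x v ρ z * u z
      = ∫ z in Ω, -∑ j, u z * fderiv ℝ (field φ x v ρ j) z (EuclideanSpace.single j 1) := by
        congr 1; ext z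
        rw [kernelDeriv_eq hφ.contDiff, ← Finset.mul_sum]; ring
    _ = ∑ j, ∫ z in Ω, f j z * field φ x v ρ j z := by
        rw [integral_neg, integral_finsetSum _ fun j _ => hi j, ← Finset.sum_neg_distrib]
        refine Finset.sum_congr rfl fun j _ => ?_
        rw [hw _ (contDiff_field hφ.contDiff x v ρ j) (hc j)
          ((tsupport_field hφ.eq_zero x v hρ j).trans hΩ) j, neg_neg]

theorem integral_abs_le {α : Type*} [MeasurableSpace α] {μ : Measure α} [IsFiniteMeasure μ]
    {g : α → ℝ} {p : ℝ} (hp : 1 < p) (hg : MemLp g (ENNReal.ofReal p) μ) :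
    ∫ a, |g a| ∂μ ≤ (∫ a, |g a| ^ p ∂μ) ^ (1 / p) * μ.real univ ^ (1 - 1 / p) := by
  have hq := Real.HolderConjugate.conjExponent hp
  have h := integral_mul_le_Lp_mul_Lq_of_nonneg hq (μ := μ) (f := fun a => |g a|)
    (g := fun _ => 1) (Filter.Eventually.of_forall fun a => abs_nonneg _)
    (Filter.Eventually.of_forall fun a => zero_le_one) hg.abs (memLp_const 1)
  have h2 : 1 / p.conjExponent = 1 - 1 / p := by
    have := hq.inv_add_inv_eq_one
    rw [one_div, one_div]; linarith
  simpa [h2] using h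

/-- The field has size ρ⁻ⁿ on a ball of volume proportional to ρⁿ, so Hölder leaves ρ^(-n/p), which
is integrable at 0 precisely because n < p. -/
theorem abs_integral_field_le (hφ : IsMollifier φ B D)
    {Ω : Set (EuclideanSpace ℝ (Fin n))} (hΩm : MeasurableSet Ω)
    {g : EuclideanSpace ℝ (Fin n) → ℝ} {p : ℝ} (hp : 1 < p)
    (hg : MemLp g (ENNReal.ofReal p) (volume.restrict Ω))
    {x v : EuclideanSpace ℝ (Fin n)} (hv : ‖v‖ ≤ 1) {ρ A : ℝ} (hρ : 0 < ρ)
    (hΩ : Metric.closedBall (x + ρ • v) ρ ⊆ Ω)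
    (hA : ∫ z in Metric.closedBall (x + ρ • v) ρ, |g z| ^ p ≤ A) (j : Fin n) :
    |∫ z in Ω, g z * field φ x v ρ j z| ≤
      2 * B * volume.real (Metric.closedBall (0 : EuclideanSpace ℝ (Fin n)) 1) ^ (1 - 1 / p)
        * A ^ (1 / p) * ρ ^ (-(n / p : ℝ)) := by
  have hB0 : 0 ≤ B := (abs_nonneg _).trans (hφ.abs_le 0)
  set S := Metric.closedBall (x + ρ • v) ρ with hS
  have hgS : MemLp g (ENNReal.ofReal p) (volume.restrict S) :=
    hg.mono_measure (Measure.restrict_mono hΩ le_rfl)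
  have : IsFiniteMeasure (volume.restrict S) :=
    isFiniteMeasure_restrict.2 measure_closedBall_lt_top.ne
  have h1 : ∫ z in Ω, g z * field φ x v ρ j z = ∫ z in S, g z * field φ x v ρ j z := by
    refine setIntegral_eq_of_subset_of_forall_sdiff_eq_zero hΩm hΩ fun z hz => ?_
    have : field φ x v ρ j z = 0 := by
      by_contra h0
      exact hz.2 (tsupport_field hφ.eq_zero x v hρ j (subset_tsupport _ h0))
    rw [this, mul_zero]
  rw [h1, ← Real.norm_eq_abs]
  have hint : IntegrableOn g S :=
    hgS.integrable (by rw [ENNReal.one_le_ofReal]; exact hp.le)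
  have hvol : (volume.restrict S).real univ =
      ρ ^ n * volume.real (Metric.closedBall (0 : EuclideanSpace ℝ (Fin n)) 1) := by
    rw [measureReal_restrict_apply_univ, Measure.addHaar_real_closedBall' _ _ hρ.le]
    simp
  calc ‖∫ z in S, g z * field φ x v ρ j z‖
      ≤ ∫ z in S, 2 * B * ρ⁻¹ ^ n * |g z| := by
        refine norm_integral_le_of_norm_le (hint.abs.const_mul _)
          (Filter.Eventually.of_forall fun z => ?_)
        rw [norm_mul, mul_comm]
        exact mul_le_mul_of_nonneg_right
          (abs_field_le hφ.abs_le hφ.eq_zero hv hρ j z) (norm_nonneg _)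
    _ = 2 * B * ρ⁻¹ ^ n * ∫ z in S, |g z| := integral_const_mul _ _
    _ ≤ 2 * B * ρ⁻¹ ^ n * (A ^ (1 / p) * (ρ ^ n *
          volume.real (Metric.closedBall (0 : EuclideanSpace ℝ (Fin n)) 1)) ^ (1 - 1 / p)) := by
        gcongr
        refine (integral_abs_le hp hgS).trans ?_
        rw [hvol]
        gcongr
    _ = _ := by
        rw [Real.mul_rpow (by positivity) measureReal_nonneg]
        have : (ρ ^ n) ^ (1 - 1 / p) = ρ ^ n * ρ ^ (-(n / p : ℝ)) := by
          rw [← Real.rpow_natCast, ← Real.rpow_mul hρ.le, ← Real.rpow_add hρ]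
          congr 1; ring
        rw [this]
        have h0 : ρ⁻¹ ^ n * ρ ^ n = 1 := by rw [inv_pow, inv_mul_cancel₀ (by positivity)]
        linear_combination (2 * B * A ^ (1 / p) * ρ ^ (-(n / p : ℝ)) *
          volume.real (Metric.closedBall (0 : EuclideanSpace ℝ (Fin n)) 1) ^ (1 - 1 / p)) * h0

theorem abs_integral_kernel_sub_le (hφ : IsMollifier φ B D)
    {Ω : Set (EuclideanSpace ℝ (Fin n))} (hΩm : MeasurableSet Ω)
    {u : EuclideanSpace ℝ (Fin n) → ℝ} (hu : IntegrableOn u Ω)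
    {x v : EuclideanSpace ℝ (Fin n)} (hv : ‖v‖ ≤ 1) {s ε : ℝ} (hs : 0 < s)
    (hΩ : Metric.closedBall (x + s • v) s ⊆ Ω)
    (hε : ∀ z ∈ Ω, dist z x ≤ 2 * s → |u z - u x| ≤ ε) :
    |(∫ z in Ω, kernel φ x v s z * u z) - u x| ≤ ε := by
  have hone : ∫ z in Ω, kernel φ x v s z = 1 := by
    rw [setIntegral_eq_integral_of_forall_compl_eq_zero, integral_kernel hφ x v hs]
    exact fun z hz => kernel_eq_zero hφ hs fun h => hz (hΩ h)
  have hki : Integrable (kernel φ x v s) (volume.restrict Ω) := by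
    by_contra h
    rw [integral_undef h] at hone
    exact zero_ne_one hone
  have hkui : Integrable (fun z => kernel φ x v s z * u z) (volume.restrict Ω) :=
    hu.bdd_mul (c := s⁻¹ ^ n * B) (continuous_kernel hφ x v s).aestronglyMeasurable
      (Filter.Eventually.of_forall fun z => abs_kernel_le hφ x v hs z)
  have h1 : (∫ z in Ω, kernel φ x v s z * u z) - u x
      = ∫ z in Ω, kernel φ x v s z * (u z - u x) := by
    simp_rw [mul_sub]
    rw [integral_sub hkui (hki.mul_const _), integral_mul_const, hone, one_mul]
  rw [h1, ← Real.norm_eq_abs]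
  calc _ ≤ ∫ z in Ω, kernel φ x v s z * ε := by
        refine norm_integral_le_of_norm_le (hki.mul_const ε)
          ((ae_restrict_mem hΩm).mono fun z hz => ?_)
        rw [norm_mul, Real.norm_of_nonneg (kernel_nonneg hφ x v hs z)]
        by_cases hm : z ∈ Metric.closedBall (x + s • v) s
        · refine mul_le_mul_of_nonneg_left (hε z hz ?_) (kernel_nonneg hφ x v hs z)
          rw [dist_eq_norm]
          exact norm_sub_le_of_mem hs hv ((mem_closedBall_iff hs).1 hm)
        · simp [kernel_eq_zero hφ hs hm]
    _ = ε := by rw [integral_mul_const, hone, one_mul]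

/-- The kernel is moved from a point mass at `x` to the mollifier on the ball about `x₀`, and the
rate of change of the average of `u` is integrated along the way. The end average does not depend on
`x`, so it can be compared with several points. -/
theorem abs_sub_integral_kernel_le (hφ : IsMollifier φ B D) {p : ℝ} (hp : 1 < p)
    (hnp : (n : ℝ) < p) {Ω : Set (EuclideanSpace ℝ (Fin n))} (hΩm : MeasurableSet Ω)
    {u : EuclideanSpace ℝ (Fin n) → ℝ} {f : Fin n → EuclideanSpace ℝ (Fin n) → ℝ}
    (huc : ContinuousOn u Ω) (hu : IntegrableOn u Ω) (hw : HasWeakGradient Ω u f)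
    (hf : ∀ j, MemLp (f j) (ENNReal.ofReal p) (volume.restrict Ω))
    {x₀ x : EuclideanSpace ℝ (Fin n)} {r A : ℝ} (hr : 0 < r)
    (hΩ : Metric.closedBall x₀ r ⊆ Ω) (hx : x ∈ Metric.closedBall x₀ r)
    (hA : ∀ j, ∫ z in Metric.closedBall x₀ r, |f j z| ^ p ≤ A) (hA0 : 0 ≤ A) :
    |u x - ∫ z in Ω, kernel φ x₀ 0 r z * u z| ≤
      n * (2 * B * volume.real (Metric.closedBall (0 : EuclideanSpace ℝ (Fin n)) 1) ^ (1 - 1 / p)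
        * A ^ (1 / p)) / (1 - n / p) * r ^ (1 - n / p : ℝ) := by
  set K := n * (2 * B * volume.real (Metric.closedBall (0 : EuclideanSpace ℝ (Fin n)) 1)
    ^ (1 - 1 / p) * A ^ (1 / p)) with hK
  have hB0 : 0 ≤ B := (abs_nonneg _).trans (hφ.abs_le 0)
  have hK0 : 0 ≤ K := by positivity
  have ha : 0 < 1 - n / p := by
    rw [sub_pos, div_lt_one (by linarith)]; exact hnp
  -- With this direction the balls B(x + sv, s) increase from `x` at s = 0 to B(x₀, r) at s = r, all
  -- inside B(x₀, r).
  set v := r⁻¹ • (x₀ - x) with hvdef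
  have hxr : ‖x₀ - x‖ ≤ r := by
    rw [norm_sub_rev, ← dist_eq_norm]; exact hx
  have hv : ‖v‖ ≤ 1 := by
    rw [hvdef, norm_smul, norm_inv, Real.norm_of_nonneg hr.le, inv_mul_le_iff₀ hr, mul_one]
    exact hxr
  have hsub : ∀ s, 0 < s → s ≤ r → Metric.closedBall (x + s • v) s ⊆ Metric.closedBall x₀ r := by
    intro s hs hsr
    refine Metric.closedBall_subset_closedBall' ?_
    have : x + s • v - x₀ = -((1 - s / r) • (x₀ - x)) := by
      rw [hvdef, smul_smul, sub_smul, one_smul, div_eq_mul_inv]; abel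
    rw [dist_eq_norm, this, norm_neg, norm_smul,
      Real.norm_of_nonneg (sub_nonneg.2 ((div_le_one hr).2 hsr))]
    have h1 : (1 - s / r) * ‖x₀ - x‖ ≤ (1 - s / r) * r := by
      gcongr
      exact sub_nonneg.2 ((div_le_one hr).2 hsr)
    have h2 : (1 - s / r) * r = r - s := by field_simp
    linarith
  set G : ℝ → ℝ := fun s => ∫ z in Ω, kernel φ x v s z * u z with hG
  have hGr : ∫ z in Ω, kernel φ x₀ 0 r z * u z = G r := by
    simp only [hG, kernel]
    congr 1; ext z
    rw [hvdef, ← smul_sub]; simp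
  have hGd : ∀ s, 0 < s → s ≤ r →
      HasDerivAt G (∑ j, ∫ z in Ω, f j z * field φ x v s j z) s := fun s hs hsr =>
    hasDerivAt_integral_kernel hφ hu hw hv hs ((hsub s hs hsr).trans hΩ)
  have hbound : ∀ s, 0 < s → s ≤ r →
      |∑ j, ∫ z in Ω, f j z * field φ x v s j z| ≤ K * s ^ (-(n / p : ℝ)) := by
    intro s hs hsr
    refine (Finset.abs_sum_le_sum_abs _ _).trans ?_
    refine (Finset.sum_le_card_nsmul _ _ _ fun j _ => abs_integral_field_le hφ hΩm hp (hf j) hv hs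
      ((hsub s hs hsr).trans hΩ) (A := A) ?_ j).trans ?_
    · refine le_trans (setIntegral_mono_set ?_ ?_ (hsub s hs hsr).eventuallyLE) (hA j)
      · have := ((hf j).mono_measure (Measure.restrict_mono hΩ le_rfl)).integrable_norm_rpow
          (by simp; linarith) (by simp)
        rwa [ENNReal.toReal_ofReal (by linarith)] at this
      · exact Filter.Eventually.of_forall fun z => by positivity
    · simp only [Finset.card_univ, Fintype.card_fin, nsmul_eq_mul, hK]
      exact le_of_eq (by ring)
  have hstep : ∀ s, 0 < s → s ≤ r → |G r - G s| ≤ K / (1 - n / p) * r ^ (1 - n / p : ℝ) := by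
    intro s hs hsr
    have h := image_norm_le_of_norm_deriv_right_le_deriv_boundary' (a := s) (b := r)
      (f := fun t => G t - G s) (f' := fun t => ∑ j, ∫ z in Ω, f j z * field φ x v t j z)
      (B := fun t => K / (1 - n / p) * (t ^ (1 - n / p : ℝ) - s ^ (1 - n / p : ℝ)))
      (B' := fun t => K * t ^ (-(n / p : ℝ)))
      (fun t ht => ((hGd t (hs.trans_le ht.1) ht.2).sub_const _).continuousAt.continuousWithinAt)
      (fun t ht => ((hGd t (hs.trans_le ht.1) ht.2.le).sub_const _).hasDerivWithinAt)
      (by simp)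
      (fun t ht => by
        have ht0 : t ≠ 0 := (hs.trans_le ht.1).ne'
        refine ContinuousAt.continuousWithinAt ?_
        exact ((Real.continuousAt_rpow_const t _ (Or.inl ht0)).sub continuousAt_const).const_mul _)
      (fun t ht => by
        have ht0 : t ≠ 0 := (hs.trans_le ht.1).ne'
        refine HasDerivAt.hasDerivWithinAt ?_
        have := ((Real.hasDerivAt_rpow_const (x := t) (p := 1 - n / p) (Or.inl ht0)).sub_const
          (s ^ (1 - n / p : ℝ))).const_mul (K / (1 - n / p))
        refine this.congr_deriv ?_
        rw [show (1 - n / p - 1 : ℝ) = -(n / p) by ring, ← mul_assoc,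
          div_mul_cancel₀ _ ha.ne'])
      (fun t ht => hbound t (hs.trans_le ht.1) ht.2.le) (right_mem_Icc.2 hsr)
    refine h.trans ?_
    have : 0 ≤ s ^ (1 - n / p : ℝ) := by positivity
    have h0 : 0 ≤ K / (1 - n / p) := by positivity
    nlinarith
  rw [hGr]
  refine le_of_forall_pos_le_add fun ε hε => ?_
  -- The kernel of scale `s` lives within distance 2s of `x`, so s ≤ δ/3 makes its average ε-close
  -- to `u x`.
  obtain ⟨δ, hδ, hδu⟩ := Metric.continuousWithinAt_iff.1 (huc x (hΩ hx)) ε hε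
  set s := min r (δ / 3) with hsdef
  have hs : 0 < s := lt_min hr (by positivity)
  have hsδ : 2 * s < δ := by
    have := min_le_right r (δ / 3); linarith
  have h1 : |G s - u x| ≤ ε := abs_integral_kernel_sub_le hφ hΩm hu hv hs
    ((hsub s hs (min_le_left _ _)).trans hΩ)
    fun z hz hzd => (hδu hz (hzd.trans_lt hsδ)).le
  have h2 := hstep s hs (min_le_left _ _)
  rw [abs_le] at *
  constructor <;> linarith [h1.1, h1.2, h2.1, h2.2]

/-- **Morrey's inequality** for a function with weak gradient in `L^p`, `p > n`. -/
theorem exists_forall_abs_sub_le {p : ℝ} (hp : 1 < p) (hnp : (n : ℝ) < p) :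
    ∃ C : ℝ, 0 ≤ C ∧ ∀ (Ω : Set (EuclideanSpace ℝ (Fin n)))
      (u : EuclideanSpace ℝ (Fin n) → ℝ) (f : Fin n → EuclideanSpace ℝ (Fin n) → ℝ),
      MeasurableSet Ω → ContinuousOn u Ω → IntegrableOn u Ω → HasWeakGradient Ω u f →
      (∀ j, MemLp (f j) (ENNReal.ofReal p) (volume.restrict Ω)) →
      ∀ (x₀ x : EuclideanSpace ℝ (Fin n)) (r : ℝ), 0 < r → Metric.closedBall x₀ r ⊆ Ω →
        x ∈ Metric.closedBall x₀ r → |u x - u x₀| ≤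
          C * r * ((∑ j, ∫ z in Metric.closedBall x₀ r, |f j z| ^ p) / r ^ n) ^ (1 / p) := by
  obtain ⟨φ, B, D, hφ⟩ := exists_isMollifier n
  have hB0 : 0 ≤ B := (abs_nonneg _).trans (hφ.abs_le 0)
  have ha : 0 < 1 - n / p := by
    rw [sub_pos, div_lt_one (by linarith)]; exact hnp
  -- The leading 2 arises because `x` and `x₀` are each compared with the same average.
  refine ⟨2 * (n * (2 * B * volume.real (Metric.closedBall (0 : EuclideanSpace ℝ (Fin n)) 1)
    ^ (1 - 1 / p)) / (1 - n / p)), by positivity, ?_⟩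
  intro Ω u f hΩm huc hu hw hf x₀ x r hr hΩ hx
  set A := ∑ j, ∫ z in Metric.closedBall x₀ r, |f j z| ^ p with hAdef
  have hj : ∀ j, 0 ≤ ∫ z in Metric.closedBall x₀ r, |f j z| ^ p := fun j =>
    integral_nonneg fun z => by positivity
  have hA : ∀ j, ∫ z in Metric.closedBall x₀ r, |f j z| ^ p ≤ A := fun j =>
    Finset.single_le_sum (f := fun j => ∫ z in Metric.closedBall x₀ r, |f j z| ^ p)
      (fun i _ => hj i) (Finset.mem_univ j)
  have hA0 : 0 ≤ A := Finset.sum_nonneg fun j _ => hj j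
  have h1 := abs_sub_integral_kernel_le hφ hp hnp hΩm huc hu hw hf hr hΩ hx hA hA0
  have h2 := abs_sub_integral_kernel_le hφ hp hnp hΩm huc hu hw hf hr hΩ
    (Metric.mem_closedBall_self hr.le) hA hA0
  have h3 : r * (A / r ^ n) ^ (1 / p) = A ^ (1 / p) * r ^ (1 - n / p : ℝ) := by
    rw [Real.div_rpow hA0 (by positivity), ← Real.rpow_natCast, ← Real.rpow_mul hr.le,
      Real.rpow_sub hr, Real.rpow_one]
    ring_nf
  rw [mul_assoc _ r, h3]
  rw [abs_le] at *
  constructor <;> ring_nf at h1 h2 ⊢ <;> linarith [h1.1, h1.2, h2.1, h2.2]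

end Morrey

/-! ### Calculus of weak gradients -/

theorem HasWeakGradient.of_lipschitzWith {n : ℕ} {u : EuclideanSpace ℝ (Fin n) → ℝ} {K : NNReal}
    (hu : LipschitzWith K u) (Ω : Set (EuclideanSpace ℝ (Fin n))) :
    HasWeakGradient Ω u fun j x => lineDeriv ℝ u x (EuclideanSpace.single j 1) := by
  intro φ hφ hc hs j
  obtain ⟨C, hC⟩ := hφ.lipschitzWith_of_hasCompactSupport hc (by simp)
  have h := LipschitzWith.integral_lineDeriv_mul_eq (μ := volume) hu hC hc
    (EuclideanSpace.single j 1)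
  rw [setIntegral_eq_integral_of_forall_compl_eq_zero,
    setIntegral_eq_integral_of_forall_compl_eq_zero, h, ← integral_neg]
  · congr 1; ext x
    rw [((hφ.differentiable (by simp)) x).lineDeriv_eq_fderiv, map_neg]; ring
  · intro x hx
    rw [image_eq_zero_of_notMem_tsupport fun h => hx (hs h), mul_zero]
  · intro x hx
    rw [fderiv_of_notMem_tsupport (𝕜 := ℝ) fun h => hx (hs h)]
    simp

theorem HasWeakGradient.congr {n : ℕ} {Ω : Set (EuclideanSpace ℝ (Fin n))}
    {u : EuclideanSpace ℝ (Fin n) → ℝ} {f g : Fin n → EuclideanSpace ℝ (Fin n) → ℝ}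
    (hu : HasWeakGradient Ω u f) (h : ∀ j, f j =ᵐ[volume.restrict Ω] g j) :
    HasWeakGradient Ω u g := by
  intro φ hφ hc hs j
  rw [hu φ hφ hc hs j]
  congr 1
  refine integral_congr_ae ?_
  filter_upwards [h j] with x hx
  rw [hx]

theorem HasWeakGradient.sub {n : ℕ} {Ω : Set (EuclideanSpace ℝ (Fin n))}
    {u v : EuclideanSpace ℝ (Fin n) → ℝ} {f g : Fin n → EuclideanSpace ℝ (Fin n) → ℝ}
    (hu : HasWeakGradient Ω u f) (hv : HasWeakGradient Ω v g)
    (hui : IntegrableOn u Ω) (hvi : IntegrableOn v Ω)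
    (hfi : ∀ j, IntegrableOn (f j) Ω) (hgi : ∀ j, IntegrableOn (g j) Ω) :
    HasWeakGradient Ω (fun x => u x - v x) fun j x => f j x - g j x := by
  intro φ hφ hc hs j
  have hd : Continuous fun z => fderiv ℝ φ z (EuclideanSpace.single j 1) :=
    (hφ.continuous_fderiv (by simp)).clm_apply continuous_const
  obtain ⟨K, hK⟩ := (hc.fderiv_apply ℝ (EuclideanSpace.single j
      (1 : ℝ))).exists_bound_of_continuous hd
  obtain ⟨K', hK'⟩ := hc.exists_bound_of_continuous hφ.continuous
  have i1 : ∀ w, IntegrableOn w Ω →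
      IntegrableOn (fun x => w x * fderiv ℝ φ x (EuclideanSpace.single j 1)) Ω := fun w hw =>
    hw.mul_bdd (c := K) hd.aestronglyMeasurable (Filter.Eventually.of_forall hK)
  have i2 : ∀ w, IntegrableOn w Ω → IntegrableOn (fun x => w x * φ x) Ω := fun w hw =>
    hw.mul_bdd (c := K') hφ.continuous.aestronglyMeasurable (Filter.Eventually.of_forall hK')
  simp_rw [sub_mul]
  rw [integral_sub (i1 u hui) (i1 v hvi), integral_sub (i2 _ (hfi j)) (i2 _ (hgi j)),
    hu φ hφ hc hs j, hv φ hφ hc hs j]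
  ring

/-- The linear form with coefficients `q`. -/
noncomputable def coordForm {n : ℕ} (q : Fin n → ℝ) : EuclideanSpace ℝ (Fin n) →L[ℝ] ℝ :=
  ∑ j, q j • EuclideanSpace.proj (𝕜 := ℝ) j

theorem coordForm_apply {n : ℕ} (q : Fin n → ℝ) (x : EuclideanSpace ℝ (Fin n)) :
    coordForm q x = ∑ j, q j * x j := by
  simp [coordForm]

theorem hasWeakGradient_coordForm {n : ℕ} (q : Fin n → ℝ) (Ω : Set (EuclideanSpace ℝ (Fin n))) :
    HasWeakGradient Ω (coordForm q) fun j _ => q j := by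
  refine (HasWeakGradient.of_lipschitzWith (coordForm q).lipschitz Ω).congr fun j => ?_
  refine Filter.Eventually.of_forall fun x => ?_
  simp only
  rw [(coordForm q).differentiableAt.lineDeriv_eq_fderiv, ContinuousLinearMap.fderiv,
    coordForm_apply]
  simp

/-! ### Lebesgue points and differentiability almost everywhere -/

open Filter Topology in
/-- Almost every point is a Lebesgue point in the sense of `L^p`. -/
theorem ae_tendsto_integral_abs_sub_rpow {n : ℕ} {p : ℝ} (hp : 1 < p)
    {Ω : Set (EuclideanSpace ℝ (Fin n))} (hΩ : IsOpen Ω) (hΩf : volume Ω ≠ ⊤)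
    {g : EuclideanSpace ℝ (Fin n) → ℝ} (hg : MemLp g (ENNReal.ofReal p) (volume.restrict Ω)) :
    ∀ᵐ x ∂(volume.restrict Ω), Tendsto
      (fun r : ℝ => (∫ z in Metric.closedBall x r, |g z - g x| ^ p) / r ^ n) (𝓝[>] 0) (𝓝 0) := by
  have hp0 : 0 < p := by linarith
  have : IsFiniteMeasure (volume.restrict Ω) := isFiniteMeasure_restrict.2 hΩf
  set β := volume.real (Metric.closedBall (0 : EuclideanSpace ℝ (Fin n)) 1) with hβ
  have hβ0 : 0 < β := ENNReal.toReal_pos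
    (Metric.measure_closedBall_pos volume _ one_pos).ne' measure_closedBall_lt_top.ne
  have hvol : ∀ (x : EuclideanSpace ℝ (Fin n)) (r : ℝ), 0 < r →
      volume.real (Metric.closedBall x r) = r ^ n * β := fun x r hr => by
    rw [Measure.addHaar_real_closedBall' _ _ hr.le]; simp [hβ]
  have hint : ∀ q : ℝ, IntegrableOn (fun z => |g z - q| ^ p) Ω := fun q => by
    have := (hg.sub (memLp_const q)).integrable_norm_rpow (by simp [hp0]) (by simp)
    rwa [ENNReal.toReal_ofReal hp0.le] at this
  have hleb : ∀ᵐ x ∂(volume.restrict Ω), ∀ q : ℚ, Tendsto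
      (fun r : ℝ => (∫ z in Metric.closedBall x r, |g z - q| ^ p) / r ^ n) (𝓝[>] 0)
      (𝓝 (β * |g x - q| ^ p)) := by
    rw [ae_all_iff]
    intro q
    have hi := (integrable_indicator_iff hΩ.measurableSet).2 (hint q)
    filter_upwards [ae_restrict_of_ae (IsUnifLocDoublingMeasure.ae_tendsto_average
      (μ := volume) hi.locallyIntegrable 1), ae_restrict_mem hΩ.measurableSet] with x hx hxΩ
    have h := (hx (l := 𝓝[>] 0) (fun _ => x) (fun r : ℝ => r) tendsto_id
      (by filter_upwards [self_mem_nhdsWithin] with r hr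
          simpa using (mem_Ioi.1 hr).le)).const_mul β
    rw [indicator_of_mem hxΩ] at h
    refine h.congr' ?_
    obtain ⟨ε, hε, hεΩ⟩ := Metric.isOpen_iff.1 hΩ x hxΩ
    filter_upwards [Ioo_mem_nhdsGT hε] with r hr
    rw [setAverage_eq, hvol x r hr.1, smul_eq_mul]
    have hsub : Metric.closedBall x r ⊆ Ω :=
      (Metric.closedBall_subset_ball hr.2).trans hεΩ
    rw [setIntegral_congr_fun Metric.isClosed_closedBall.measurableSet
      fun z hz => indicator_of_mem (hsub hz) _]
    have := hr.1
    field_simp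
  filter_upwards [hleb, ae_restrict_mem hΩ.measurableSet] with x hx hxΩ
  obtain ⟨ε₀, hε₀, hεΩ⟩ := Metric.isOpen_iff.1 hΩ x hxΩ
  rw [Metric.tendsto_nhds]
  intro ε hε
  -- The Lebesgue theorem is available for |g - q|^p with countably many `q` at once; a rational `q`
  -- near `g x` then replaces `g x` at a small cost.
  have hq : ∃ q : ℚ, 2 ^ p * (2 * β * |g x - q| ^ p) < ε := by
    have hc : ContinuousAt (fun t : ℝ => 2 ^ p * (2 * β * |g x - t| ^ p)) (g x) := by
      refine ContinuousAt.const_mul (ContinuousAt.const_mul ?_ _) _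
      exact ContinuousAt.rpow_const (by fun_prop) (Or.inr hp0.le)
    have hlt : (2 : ℝ) ^ p * (2 * β * |g x - g x| ^ p) < ε := by
      simp [Real.zero_rpow hp0.ne', hε]
    obtain ⟨U, hU, hUo, hUx⟩ := eventually_nhds_iff.1 (hc.eventually_lt_const hlt)
    obtain ⟨q, hqU⟩ := Rat.denseRange_cast.exists_mem_open hUo ⟨_, hUx⟩
    exact ⟨q, hU _ hqU⟩
  obtain ⟨q, hq⟩ := hq
  have hlim : Tendsto (fun r : ℝ => 2 ^ p * ((∫ z in Metric.closedBall x r, |g z - q| ^ p) / r ^ n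
      + β * |g x - q| ^ p)) (𝓝[>] 0) (𝓝 (2 ^ p * (β * |g x - q| ^ p + β * |g x - q| ^ p))) :=
    ((hx q).add_const _).const_mul _
  filter_upwards [Ioo_mem_nhdsGT hε₀, hlim.eventually_lt_const
    (show 2 ^ p * (β * |g x - q| ^ p + β * |g x - q| ^ p) < ε by linarith)] with r hr hlt
  have hr0 : 0 < r := hr.1
  have hsub : Metric.closedBall x r ⊆ Ω := (Metric.closedBall_subset_ball hr.2).trans hεΩ
  have hfin : IsFiniteMeasure (volume.restrict (Metric.closedBall x r)) :=
    isFiniteMeasure_restrict.2 measure_closedBall_lt_top.ne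
  rw [Real.dist_eq, sub_zero, abs_of_nonneg
    (div_nonneg (integral_nonneg fun z => by positivity) (by positivity))]
  refine lt_of_le_of_lt ?_ hlt
  have h1 : ∫ z in Metric.closedBall x r, |g z - g x| ^ p ≤
      ∫ z in Metric.closedBall x r, 2 ^ p * (|g z - q| ^ p + |g x - q| ^ p) := by
    refine integral_mono ((hint _).mono_set hsub)
      ((((hint q).mono_set hsub).add (integrable_const _)).const_mul _) fun z => ?_
    simp only
    have ha : |g z - g x| ≤ 2 * max |g z - q| |g x - q| := by
      have := abs_sub_le (g z) q (g x)
      rw [abs_sub_comm (q : ℝ)] at this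
      linarith [le_max_left |g z - q| |g x - q|, le_max_right |g z - q| |g x - q|]
    calc |g z - g x| ^ p ≤ (2 * max |g z - q| |g x - q|) ^ p := by gcongr
      _ = 2 ^ p * (max |g z - q| |g x - q|) ^ p := Real.mul_rpow (by norm_num) (by positivity)
      _ ≤ _ := by
        gcongr
        rcases max_cases |g z - q| |g x - q| with h | h <;> rw [h.1]
        · exact le_add_of_nonneg_right (by positivity)
        · exact le_add_of_nonneg_left (by positivity)
  rw [integral_const_mul, integral_add ((hint q).mono_set hsub) (integrable_const _),
    integral_const, measureReal_restrict_apply_univ, hvol x r hr0, smul_eq_mul] at h1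
  rw [div_le_iff₀ (by positivity)]
  refine h1.trans (le_of_eq ?_)
  field_simp

theorem Continuous.integrableOn_of_isBounded {n : ℕ} {Ω : Set (EuclideanSpace ℝ (Fin n))}
    (hΩb : Bornology.IsBounded Ω) {u : EuclideanSpace ℝ (Fin n) → ℝ} (hu : Continuous u) :
    IntegrableOn u Ω :=
  (hu.continuousOn.integrableOn_compact hΩb.isCompact_closure).mono_set subset_closure

-- Morrey's inequality for `u` minus the linear form with coefficients `f j x` bounds the remainder
-- at distance r by r times a power of the mean p-th power deviation of the gradient from its value
-- at `x`, which tends to 0 at a Lebesgue point.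
open Filter Topology in
theorem HasWeakGradient.ae_hasFDerivAt {n : ℕ} {p : ℝ} (hp : 1 < p) (hnp : (n : ℝ) < p)
    {Ω : Set (EuclideanSpace ℝ (Fin n))} (hΩ : IsOpen Ω) (hΩb : Bornology.IsBounded Ω)
    {u : EuclideanSpace ℝ (Fin n) → ℝ} {f : Fin n → EuclideanSpace ℝ (Fin n) → ℝ}
    (huc : ContinuousOn u Ω) (hu : IntegrableOn u Ω) (hw : HasWeakGradient Ω u f)
    (hf : ∀ j, MemLp (f j) (ENNReal.ofReal p) (volume.restrict Ω)) :
    ∀ᵐ x ∂(volume.restrict Ω), HasFDerivAt u (coordForm fun j => f j x) x := by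
  have hp0 : 0 < p := by linarith
  have hΩf : volume Ω ≠ ⊤ := hΩb.measure_lt_top.ne
  have : IsFiniteMeasure (volume.restrict Ω) := isFiniteMeasure_restrict.2 hΩf
  obtain ⟨C, hC, hM⟩ := Morrey.exists_forall_abs_sub_le hp hnp
  filter_upwards [ae_all_iff.2 fun j => ae_tendsto_integral_abs_sub_rpow hp hΩ hΩf (hf j),
    ae_restrict_mem hΩ.measurableSet] with x hx hxΩ
  set q : Fin n → ℝ := fun j => f j x with hq
  have hqi := (coordForm q).continuous.integrableOn_of_isBounded hΩb
  have hfi : ∀ j, IntegrableOn (f j) Ω := fun j =>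
    (hf j).integrable (by rw [ENNReal.one_le_ofReal]; exact hp.le)
  have hmor := hM Ω (fun z => u z - coordForm q z) (fun j z => f j z - q j) hΩ.measurableSet
    (huc.sub (coordForm q).continuous.continuousOn) (hu.sub hqi)
    (hw.sub (hasWeakGradient_coordForm q Ω) hu hqi hfi fun j => integrable_const _)
    (fun j => (hf j).sub (memLp_const _)) x
  have hlim : Tendsto (fun r : ℝ =>
      C * ((∑ j, ∫ z in Metric.closedBall x r, |f j z - q j| ^ p) / r ^ n) ^ (1 / p))
      (𝓝[>] 0) (𝓝 0) := by
    have h1 : Tendsto (fun r : ℝ =>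
        (∑ j, ∫ z in Metric.closedBall x r, |f j z - q j| ^ p) / r ^ n) (𝓝[>] 0) (𝓝 0) := by
      simp_rw [Finset.sum_div]
      simpa using tendsto_finsetSum Finset.univ fun j _ => hx j
    have h2 := (h1.rpow_const (p := 1 / p) (Or.inr (by positivity))).const_mul C
    rwa [Real.zero_rpow (by positivity), mul_zero] at h2
  rw [hasFDerivAt_iff_isLittleO, Asymptotics.isLittleO_iff]
  intro ε hε
  obtain ⟨δ₁, hδ₁, h₁⟩ := mem_nhdsGT_iff_exists_Ioo_subset.1 (hlim.eventually_lt_const hε)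
  obtain ⟨δ₂, hδ₂, h₂⟩ := Metric.isOpen_iff.1 hΩ x hxΩ
  filter_upwards [Metric.ball_mem_nhds x (lt_min (mem_Ioi.1 hδ₁) hδ₂)] with z hz
  rw [Metric.mem_ball, lt_min_iff] at hz
  rcases eq_or_ne z x with rfl | hne
  · simp
  have hd : 0 < dist z x := dist_pos.2 hne
  have h3 := hmor z (dist z x) hd ((Metric.closedBall_subset_ball hz.2).trans h₂)
    (Metric.mem_closedBall.2 le_rfl)
  have h4 := h₁ (show dist z x ∈ Ioo 0 δ₁ from ⟨hd, hz.1⟩)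
  rw [mem_ofPred_eq] at h4
  have h5 : u z - u x - coordForm q (z - x) = u z - coordForm q z - (u x - coordForm q x) := by
    rw [map_sub]; ring
  rw [h5, Real.norm_eq_abs, ← dist_eq_norm]
  refine h3.trans ?_
  rw [mul_right_comm]
  gcongr

/-! ### Lusin's property and the area formula -/

namespace HasSobolevGradient

variable {n : ℕ} {p : ℝ} {Ω : Set (EuclideanSpace ℝ (Fin n))}
  {y : EuclideanSpace ℝ (Fin n) → EuclideanSpace ℝ (Fin n)}
  {F : EuclideanSpace ℝ (Fin n) → Matrix (Fin n) (Fin n) ℝ}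

theorem hasWeakGradient (h : HasSobolevGradient p Ω y F) (i : Fin n) :
    HasWeakGradient Ω (fun x => y x i) fun j x => F x i j :=
  fun φ hφ hc hs j => h.integral_eq φ hφ hc hs i j

theorem integrableOn_apply (h : HasSobolevGradient p Ω y F) (hp : 1 < p)
    (hΩb : Bornology.IsBounded Ω) (i : Fin n) : IntegrableOn (fun x => y x i) Ω := by
  have : IsFiniteMeasure (volume.restrict Ω) := isFiniteMeasure_restrict.2 hΩb.measure_lt_top.ne
  have h1 : IntegrableOn y Ω :=
    h.memLp.integrable (by rw [ENNReal.one_le_ofReal]; exact hp.le)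
  exact (EuclideanSpace.proj (𝕜 := ℝ) i).integrable_comp h1

theorem ae_hasFDerivAt (h : HasSobolevGradient p Ω y F) (hp : 1 < p) (hnp : (n : ℝ) < p)
    (hΩ : IsOpen Ω) (hΩb : Bornology.IsBounded Ω) (hy : ContinuousOn y Ω) :
    ∀ᵐ x ∂(volume.restrict Ω),
      HasFDerivAt y (LinearMap.toContinuousLinearMap (Matrix.toEuclideanLin (F x))) x := by
  have h1 : ∀ i, ∀ᵐ x ∂(volume.restrict Ω),
      HasFDerivAt (fun x => y x i) (coordForm fun j => F x i j) x := fun i =>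
    (h.hasWeakGradient i).ae_hasFDerivAt hp hnp hΩ hΩb
      ((EuclideanSpace.proj (𝕜 := ℝ) i).continuous.comp_continuousOn hy)
      (h.integrableOn_apply hp hΩb i) fun j => h.memLp_gradient i j
  filter_upwards [ae_all_iff.2 h1] with x hx
  rw [← hasFDerivWithinAt_univ, hasFDerivWithinAt_euclidean]
  intro i
  refine ((hx i).congr_fderiv ?_).hasFDerivWithinAt
  ext z
  simp [coordForm_apply, Matrix.toLpLin_apply, Matrix.mulVec, dotProduct]

/-- **Lusin's property (N)** for continuous maps of class `W^{1,p}`, `p > n`. -/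
theorem volume_image_eq_zero (h : HasSobolevGradient p Ω y F) (hp : 1 < p) (hnp : (n : ℝ) < p)
    (hΩ : IsOpen Ω) (hΩb : Bornology.IsBounded Ω) (hy : ContinuousOn y Ω)
    {N : Set (EuclideanSpace ℝ (Fin n))} (hN : N ⊆ Ω) (hN0 : volume N = 0) :
    volume (y '' N) = 0 := by
  have hp0 : 0 < p := by linarith
  have hfinΩ : IsFiniteMeasure (volume.restrict Ω) :=
    isFiniteMeasure_restrict.2 hΩb.measure_lt_top.ne
  obtain ⟨C, hC, hM⟩ := Morrey.exists_forall_abs_sub_le hp hnp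
  set S : EuclideanSpace ℝ (Fin n) → ℝ := fun z => ∑ i, ∑ j, |F z i j| ^ p with hS
  have hpi : ∀ i j, IntegrableOn (fun z => |F z i j| ^ p) Ω := fun i j => by
    have := (h.memLp_gradient i j).integrable_norm_rpow (by simp [hp0]) (by simp)
    rwa [ENNReal.toReal_ofReal hp0.le] at this
  have hSi : IntegrableOn (fun z => 1 + S z) Ω :=
    (integrable_const _).add (integrable_finsetSum _ fun i _ =>
      integrable_finsetSum _ fun j _ => hpi i j)
  have hS0 : ∀ z, 0 ≤ 1 + S z := fun z => by
    have : 0 ≤ S z := Finset.sum_nonneg fun i _ => Finset.sum_nonneg fun j _ => by positivity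
    linarith
  -- A finite measure that controls the volume of images of balls: Morrey gives rⁿ(A/rⁿ)^(n/p), and
  -- t^(n/p) ≤ 1 + t bounds this by rⁿ + A. The summand 1 in the density accounts for rⁿ.
  set μ := (volume.restrict Ω).withDensity fun z => ENNReal.ofReal (1 + S z) with hμ
  have hμfin : IsFiniteMeasure μ := isFiniteMeasure_withDensity_ofReal hSi.2
  have hμN : μ N = 0 := by
    refine withDensity_absolutelyContinuous _ _ (Measure.absolutelyContinuous_of_le
      Measure.restrict_le_self hN0)
  set β := volume.real (Metric.closedBall (0 : EuclideanSpace ℝ (Fin n)) 1) with hβ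
  have hβ0 : 0 < β := ENNReal.toReal_pos
    (Metric.measure_closedBall_pos volume _ one_pos).ne' measure_closedBall_lt_top.ne
  set K : ℝ := (n * C) ^ n * (1 + β) with hK
  have hball : ∀ x r, 0 < r → Metric.closedBall x r ⊆ Ω →
      volume (y '' Metric.closedBall x r) ≤ ENNReal.ofReal K * μ (Metric.closedBall x r) := by
    intro x r hr hsub
    set A : ℝ := ∫ z in Metric.closedBall x r, S z with hA
    have hAsum : A = ∑ i, ∑ j, ∫ z in Metric.closedBall x r, |F z i j| ^ p := by
      rw [hA, integral_finsetSum _ fun i _ => integrable_finsetSum _ fun j _ =>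
        (hpi i j).mono_set hsub]
      exact Finset.sum_congr rfl fun i _ => integral_finsetSum _ fun j _ =>
        (hpi i j).mono_set hsub
    have hAi0 : ∀ i, 0 ≤ ∑ j, ∫ z in Metric.closedBall x r, |F z i j| ^ p := fun i =>
      Finset.sum_nonneg fun j _ => integral_nonneg fun z => by positivity
    have hA0 : 0 ≤ A := hAsum ▸ Finset.sum_nonneg fun i _ => hAi0 i
    set R : ℝ := n * (C * r * (A / r ^ n) ^ (1 / p)) with hR
    have hR0 : 0 ≤ R := by positivity
    have himg : y '' Metric.closedBall x r ⊆ Metric.closedBall (y x) R := by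
      rintro _ ⟨z, hz, rfl⟩
      have hcomp : ∀ i, |y z i - y x i| ≤ C * r * (A / r ^ n) ^ (1 / p) := by
        intro i
        refine (hM Ω (fun z => y z i) (fun j z => F z i j) hΩ.measurableSet
          ((EuclideanSpace.proj (𝕜 := ℝ) i).continuous.comp_continuousOn hy)
          (h.integrableOn_apply hp hΩb i) (h.hasWeakGradient i)
          (fun j => h.memLp_gradient i j) x z r hr hsub hz).trans ?_
        gcongr
        rw [hAsum]
        exact Finset.single_le_sum
          (f := fun i => ∑ j, ∫ z in Metric.closedBall x r, |F z i j| ^ p)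
          (fun i _ => hAi0 i) (Finset.mem_univ i)
      rw [Metric.mem_closedBall, dist_eq_norm]
      have hsum : y z - y x = ∑ i, (y z i - y x i) • EuclideanSpace.single i (1 : ℝ) := by
        ext k; simp [Finset.sum_apply, Pi.single_apply]
      rw [hsum]
      refine (norm_sum_le _ _).trans ((Finset.sum_le_card_nsmul _ _
        (C * r * (A / r ^ n) ^ (1 / p)) fun i _ => ?_).trans ?_)
      · rw [norm_smul, Real.norm_eq_abs]; simpa using hcomp i
      · simp [hR]
    have hRn : R ^ n * β ≤ K * (β * r ^ n + A) := by
      have hT0 : 0 ≤ A / r ^ n := by positivity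
      have h1 : ((A / r ^ n) ^ (1 / p)) ^ n ≤ 1 + A / r ^ n := by
        rw [← Real.rpow_natCast, ← Real.rpow_mul hT0]
        rcases le_total (A / r ^ n) 1 with h1 | h1
        · exact (Real.rpow_le_one hT0 h1 (by positivity)).trans (by linarith)
        · calc (A / r ^ n) ^ (1 / p * n) ≤ (A / r ^ n) ^ (1 : ℝ) := by
                refine Real.rpow_le_rpow_of_exponent_le h1 ?_
                rw [one_div_mul_eq_div, div_le_one hp0]; exact hnp.le
            _ ≤ _ := by rw [Real.rpow_one]; linarith
      have h2 : r ^ n * (1 + A / r ^ n) = r ^ n + A := by field_simp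
      calc R ^ n * β = (n * C) ^ n * (r ^ n * ((A / r ^ n) ^ (1 / p)) ^ n) * β := by
            rw [hR]; simp only [mul_pow]; ring
        _ ≤ (n * C) ^ n * (r ^ n * (1 + A / r ^ n)) * β := by gcongr
        _ = (n * C) ^ n * (β * r ^ n + β * A) := by rw [h2]; ring
        _ ≤ (n * C) ^ n * ((1 + β) * (β * r ^ n + A)) := by
            gcongr
            have : 0 ≤ β * (β * r ^ n) := by positivity
            nlinarith
        _ = _ := by rw [hK]; ring
    have hμb : μ (Metric.closedBall x r) = ENNReal.ofReal (β * r ^ n + A) := by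
      have hfinB : IsFiniteMeasure (volume.restrict (Metric.closedBall x r)) :=
        isFiniteMeasure_restrict.2 measure_closedBall_lt_top.ne
      rw [hμ, withDensity_apply _ Metric.isClosed_closedBall.measurableSet,
        Measure.restrict_restrict Metric.isClosed_closedBall.measurableSet,
        inter_eq_left.2 hsub, ← ofReal_integral_eq_lintegral_ofReal (hSi.mono_set hsub)
          (Filter.Eventually.of_forall hS0), integral_add (integrable_const _)
          (integrable_finsetSum _ fun i _ => integrable_finsetSum _ fun j _ =>
            (hpi i j).mono_set hsub), integral_const, measureReal_restrict_apply_univ,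
        Measure.addHaar_real_closedBall' _ _ hr.le]
      congr 2
      simp [hβ, mul_comm]
    calc volume (y '' Metric.closedBall x r) ≤ volume (Metric.closedBall (y x) R) :=
          measure_mono himg
      _ = ENNReal.ofReal (R ^ n * β) := by
          rw [← ENNReal.ofReal_toReal (measure_closedBall_lt_top (x := y x) (r := R)).ne]
          congr 1
          have := Measure.addHaar_real_closedBall' (volume : Measure (EuclideanSpace ℝ (Fin n)))
            (y x) hR0
          rw [finrank_euclideanSpace_fin] at this
          exact this
      _ ≤ ENNReal.ofReal (K * (β * r ^ n + A)) := ENNReal.ofReal_le_ofReal hRn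
      _ = _ := by rw [hμb, ENNReal.ofReal_mul (by positivity)]
  have hε : ∀ ε : NNReal, 0 < ε → volume (y '' N) ≤ ENNReal.ofReal K * ε := by
    intro ε hε
    -- Besicovitch's theorem covers `N` by balls inside `Ω` of total μ-mass at most μ(N) + ε = ε,
    -- overlaps counted.
    obtain ⟨t, r, htc, htN, hr, hcov, hsum⟩ :=
      Besicovitch.exists_closedBall_covering_tsum_measure_le μ (ε := ε)
        (by exact_mod_cast hε.ne') (fun x => {r | 0 < r ∧ Metric.closedBall x r ⊆ Ω}) N (by
          intro x hx δ hδ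
          obtain ⟨ρ, hρ, hsub⟩ := Metric.isOpen_iff.1 hΩ x (hN hx)
          have hm : 0 < min ρ δ / 2 := by positivity
          have hlt : min ρ δ / 2 < min ρ δ := half_lt_self (by positivity)
          exact ⟨min ρ δ / 2, ⟨hm, (Metric.closedBall_subset_ball
            (hlt.trans_le (min_le_left _ _))).trans hsub⟩, hm, hlt.trans_le (min_le_right _ _)⟩)
    have : Countable t := htc.to_subtype
    calc volume (y '' N) ≤ volume (⋃ x : t, y '' Metric.closedBall (x : _) (r x)) := by
          refine measure_mono ((image_mono hcov).trans ?_)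
          rw [biUnion_eq_iUnion, image_iUnion]
      _ ≤ ∑' x : t, volume (y '' Metric.closedBall (x : _) (r x)) := measure_iUnion_le _
      _ ≤ ∑' x : t, ENNReal.ofReal K * μ (Metric.closedBall (x : _) (r x)) :=
          ENNReal.tsum_le_tsum fun x => hball x _ (hr x x.2).1 (hr x x.2).2
      _ = ENNReal.ofReal K * ∑' x : t, μ (Metric.closedBall (x : _) (r x)) :=
          ENNReal.tsum_mul_left
      _ ≤ _ := by rw [hμN, zero_add] at hsum; gcongr
  refine le_antisymm (ENNReal.le_of_forall_pos_le_add fun ε hε' _ => ?_) zero_le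
  have hK0 : 0 ≤ K := by positivity
  have hc : 0 < ε / (K.toNNReal + 1) := by positivity
  refine (hε _ hc).trans ?_
  rw [zero_add, ENNReal.ofReal, ← ENNReal.coe_mul, ENNReal.coe_le_coe, mul_div_assoc',
    div_le_iff₀ (by positivity), mul_comm]
  gcongr
  exact le_self_add

/-- The **area formula** for injective continuous maps of class `W^{1,p}`, `p > n`. -/
theorem lintegral_abs_det_eq (h : HasSobolevGradient p Ω y F) (hp : 1 < p) (hnp : (n : ℝ) < p)
    (hΩ : IsOpen Ω) (hΩb : Bornology.IsBounded Ω) (hy : ContinuousOn y Ω) (hinj : InjOn y Ω) :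
    ∫⁻ x in Ω, ENNReal.ofReal |(F x).det| = volume (y '' Ω) := by
  set L : EuclideanSpace ℝ (Fin n) → EuclideanSpace ℝ (Fin n) →L[ℝ] EuclideanSpace ℝ (Fin n) :=
    fun x => LinearMap.toContinuousLinearMap (Matrix.toEuclideanLin (F x)) with hL
  have hdet : ∀ x, (L x).det = (F x).det := fun x => by
    rw [hL, ContinuousLinearMap.det]
    simp [Matrix.toEuclideanLin_eq_toLin_orthonormal, LinearMap.det_toLin]
  have hd := h.ae_hasFDerivAt hp hnp hΩ hΩb hy
  -- The classical area formula applies on the differentiability set `T`; the rest of `Ω` is null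
  -- and, by property (N), has null image.
  set T := {x ∈ Ω | HasFDerivAt y (L x) x} with hT
  have hTN : volume (Ω \ T) = 0 := by
    rw [ae_restrict_iff' hΩ.measurableSet, ae_iff] at hd
    refine measure_mono_null (fun x hx => ?_) hd
    simp only [mem_ofPred_eq, Classical.not_imp]
    exact ⟨hx.1, fun h => hx.2 ⟨hx.1, h⟩⟩
  have hTΩ : T ⊆ Ω := fun x hx => hx.1
  have hTae : T =ᵐ[volume] Ω :=
    (ae_le_set.2 (by rw [sdiff_eq_empty.2 hTΩ, measure_empty])).antisymm (ae_le_set.2 hTN)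
  have hTm : NullMeasurableSet T volume :=
    hΩ.measurableSet.nullMeasurableSet.congr hTae.symm
  have harea := lintegral_abs_det_fderiv_eq_addHaar_image₀ volume hTm
    (fun x hx => hx.2.hasFDerivWithinAt) (hinj.mono hTΩ)
  simp_rw [hdet] at harea
  rw [← setLIntegral_congr hTae, harea]
  refine le_antisymm (measure_mono (image_mono hTΩ)) ?_
  calc volume (y '' Ω) ≤ volume (y '' T ∪ y '' (Ω \ T)) := by
        rw [← image_union, union_sdiff_cancel hTΩ]
    _ ≤ volume (y '' T) + volume (y '' (Ω \ T)) := measure_union_le _ _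
    _ = volume (y '' T) := by
        rw [h.volume_image_eq_zero hp hnp hΩ hΩb hy sdiff_subset hTN, add_zero]

end HasSobolevGradient

/-! ### Convex domains are Lipschitz -/

/-- A nonempty bounded convex open set is a bounded Lipschitz domain. -/
theorem isBoundedLipschitzDomain_of_convex {n : ℕ} {Ω : Set (EuclideanSpace ℝ (Fin n))}
    (ho : IsOpen Ω) (hc : Convex ℝ Ω) (hb : Bornology.IsBounded Ω) (hne : Ω.Nonempty) :
    IsBoundedLipschitzDomain Ω := by
  refine ⟨ho, hc.isConnected hne, hb, fun x₀ hx₀ => ?_⟩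
  obtain ⟨a, ha⟩ := hne
  obtain ⟨ρ, hρ, hρΩ⟩ := Metric.isOpen_iff.1 ho a ha
  have hx₀Ω : x₀ ∉ Ω := by
    rw [ho.frontier_eq] at hx₀; exact hx₀.2
  set R := ‖a - x₀‖ with hR
  have hρR : ρ ≤ R := by
    by_contra h
    exact hx₀Ω (hρΩ (by rw [Metric.mem_ball, dist_comm, dist_eq_norm]; exact not_le.1 h))
  have hR0 : 0 < R := hρ.trans_le hρR
  -- "Up" points from the boundary point to the centre of a ball contained in Ω.
  set e := R⁻¹ • (a - x₀) with he
  have he1 : ‖e‖ = 1 := by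
    rw [he, norm_smul, norm_inv, Real.norm_of_nonneg hR0.le, ← hR, inv_mul_cancel₀ hR0.ne']
  have hee : inner ℝ e e = 1 := by rw [real_inner_self_eq_norm_sq, he1, one_pow]
  have hRe : R • e = a - x₀ := by rw [he, smul_smul, mul_inv_cancel₀ hR0.ne', one_smul]
  set K : NNReal := (2 * R / ρ).toNNReal with hK
  have hKR : (K : ℝ) = 2 * R / ρ := Real.coe_toNNReal _ (by positivity)
  set P : EuclideanSpace ℝ (Fin n) → EuclideanSpace ℝ (Fin n) := fun x => x - inner ℝ e x • e
    with hP
  set r := ρ / 2 with hr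
  have hr0 : 0 < r := by positivity
  set V := Ω ∩ Metric.ball x₀ r with hV
  have hVo : IsOpen V := ho.inter Metric.isOpen_ball
  have hVne : Nonempty V := by
    obtain ⟨z, hz, hzd⟩ := Metric.mem_closure_iff.1 (frontier_subset_closure hx₀) r hr0
    exact ⟨z, hz, by rw [Metric.mem_ball, dist_comm]; exact hzd⟩
  -- The lower envelope of the upward cones of slope `K` with apex in `V`, which is `K`-Lipschitz by
  -- construction. Near x₀, a point above it lies in one of these cones and must be shown to be in
  -- Ω.
  set γ : EuclideanSpace ℝ (Fin n) → ℝ := fun x => ⨅ z : V, (inner ℝ e z.1 + K * dist x (P z.1))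
    with hγ
  have hbdd : ∀ x, BddBelow (range fun z : V => inner ℝ e z.1 + K * dist x (P z.1)) := by
    intro x
    refine ⟨-(‖x₀‖ + r), ?_⟩
    rintro _ ⟨z, rfl⟩
    have h1 : |inner ℝ e z.1| ≤ ‖z.1‖ := by simpa [he1] using abs_real_inner_le_norm e z.1
    have h2 : ‖z.1‖ ≤ ‖x₀‖ + r := by
      have h3 : ‖z.1 - x₀‖ < r := by rw [← dist_eq_norm]; exact z.2.2
      linarith [norm_le_norm_add_norm_sub' z.1 x₀]
    have h4 : 0 ≤ K * dist x (P z.1) := by positivity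
    simp only
    linarith [neg_abs_le (inner ℝ e z.1)]
  refine ⟨e, γ, K, r, he1, LipschitzWith.of_le_add_mul K fun x x' => ?_, hr0, fun x hx => ?_⟩
  · rw [← sub_le_iff_le_add]
    refine le_ciInf fun z => ?_
    rw [sub_le_iff_le_add]
    refine (ciInf_le (hbdd x) z).trans ?_
    have := mul_le_mul_of_nonneg_left (dist_triangle x x' (P z.1)) K.2
    rw [mul_add] at this
    change _ ≤ _ at this
    simp only [NNReal.val_eq_coe] at this
    linarith
  · change x ∈ Ω ↔ γ (P x) < inner ℝ e x
    constructor
    · intro hxΩ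
      obtain ⟨δ, hδ, hδV⟩ := Metric.isOpen_iff.1 hVo x ⟨hxΩ, hx⟩
      have hz : x - (δ / 2) • e ∈ V := hδV (by
        rw [Metric.mem_ball, dist_eq_norm, sub_sub_cancel_left, norm_neg, norm_smul, he1, mul_one,
          Real.norm_of_nonneg (by positivity)]
        exact half_lt_self hδ)
      refine (ciInf_le (hbdd _) ⟨_, hz⟩).trans_lt ?_
      have hPz : P (x - (δ / 2) • e) = P x := by
        simp only [hP, inner_sub_right, inner_smul_right, hee, sub_smul, mul_one]
        abel
      simp only
      rw [hPz, dist_self, mul_zero, add_zero, inner_sub_right, inner_smul_right, hee]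
      linarith
    · intro h
      obtain ⟨⟨z, hzΩ, hzb⟩, hz⟩ := exists_lt_of_ciInf_lt h
      simp only at hz
      set w := x - z with hw
      set t := inner ℝ e w with ht
      have hPw : ‖P w‖ * K < t := by
        have h1 : P x - P z = P w := by
          simp only [hP, hw, inner_sub_right, sub_smul]; abel
        rw [dist_eq_norm, h1] at hz
        rw [ht, hw, inner_sub_right]; linarith
      have ht0 : 0 < t := lt_of_le_of_lt (by positivity) hPw
      have htR : t ≤ R := by
        have h1 : t ≤ ‖w‖ := by simpa [he1] using real_inner_le_norm e w
        have h2 : ‖w‖ < 2 * r := by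
          rw [hw, ← dist_eq_norm]
          have := dist_triangle_right x z x₀
          rw [Metric.mem_ball] at hx hzb
          linarith
        linarith
      set s := t / R with hs
      have hs0 : 0 < s := by positivity
      have hs1 : s ≤ 1 := (div_le_one hR0).2 htR
      have hwe : w = s • (a - x₀) + P w := by
        rw [← hRe, smul_smul, hs, div_mul_cancel₀ _ hR0.ne']
        simp [hP, ht]
      -- Extending the segment from `z` through `x` to height R above `z` lands in the ball about
      -- `a`: `z` is within ρ/2 of x₀, and the slope 2R/ρ allows a sideways drift of at most ρ/2.
      -- Convexity then puts `x` in Ω.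
      set b := z + s⁻¹ • w with hbdef
      have hbΩ : b ∈ Ω := by
        refine hρΩ ?_
        have h1 : b - a = (z - x₀) + s⁻¹ • P w := by
          rw [hbdef, hwe, smul_add, smul_smul, inv_mul_cancel₀ hs0.ne', one_smul, ← hwe]; abel
        have h2 : ‖s⁻¹ • P w‖ ≤ ρ / 2 := by
          rw [norm_smul, norm_inv, Real.norm_of_nonneg hs0.le, inv_mul_le_iff₀ hs0]
          rw [hKR] at hPw
          have h3 : ‖P w‖ * (2 * R / ρ) * (ρ / (2 * R)) ≤ t * (ρ / (2 * R)) := by gcongr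
          have h4 : ‖P w‖ * (2 * R / ρ) * (ρ / (2 * R)) = ‖P w‖ := by field_simp
          have h5 : t * (ρ / (2 * R)) = s * (ρ / 2) := by rw [hs]; field_simp
          linarith
        have h3 : ‖z - x₀‖ < ρ / 2 := by rw [← dist_eq_norm]; exact hzb
        rw [Metric.mem_ball, dist_eq_norm, h1]
        exact (norm_add_le _ _).trans_lt (by linarith)
      have hx' : x = (1 - s) • z + s • b := by
        rw [hbdef, smul_add, smul_smul, mul_inv_cancel₀ hs0.ne', one_smul, hw, sub_smul, one_smul]
        abel
      rw [hx']
      exact hc hzΩ hbΩ (by linarith) hs0.le (by ring)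

/-! ### Lipschitz maps as Sobolev maps, and extended averages -/

theorem Continuous.memLp_of_isBounded {n : ℕ} {m : ℕ} {Ω : Set (EuclideanSpace ℝ (Fin n))}
    (hm : MeasurableSet Ω) (hΩb : Bornology.IsBounded Ω)
    {u : EuclideanSpace ℝ (Fin n) → EuclideanSpace ℝ (Fin m)} (hu : Continuous u)
    (q : ENNReal) : MemLp u q (volume.restrict Ω) := by
  have : IsFiniteMeasure (volume.restrict Ω) := isFiniteMeasure_restrict.2 hΩb.measure_lt_top.ne
  obtain ⟨C, hC⟩ := hΩb.isCompact_closure.exists_bound_of_continuousOn hu.continuousOn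
  exact MemLp.of_bound hu.aestronglyMeasurable C
    ((ae_restrict_mem hm).mono fun x hx => hC x (subset_closure hx))

/-- A Lipschitz map is of class `W^{1,p}` on bounded sets, with its derivative as weak gradient. -/
theorem hasSobolevGradient_of_lipschitzWith {n : ℕ} (p : ℝ)
    {Ω : Set (EuclideanSpace ℝ (Fin n))} (hm : MeasurableSet Ω) (hΩb : Bornology.IsBounded Ω)
    {y : EuclideanSpace ℝ (Fin n) → EuclideanSpace ℝ (Fin n)}
    {F : EuclideanSpace ℝ (Fin n) → Matrix (Fin n) (Fin n) ℝ} {K : NNReal}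
    (hy : LipschitzWith K y)
    (hF : ∀ᵐ x ∂(volume.restrict Ω),
      HasFDerivAt y (LinearMap.toContinuousLinearMap (Matrix.toEuclideanLin (F x))) x) :
    HasSobolevGradient p Ω y F := by
  have : IsFiniteMeasure (volume.restrict Ω) := isFiniteMeasure_restrict.2 hΩb.measure_lt_top.ne
  have hyi : ∀ i : Fin n, LipschitzWith (‖EuclideanSpace.proj (𝕜 := ℝ) i‖₊ * K)
      fun x => y x i := fun i =>
    (EuclideanSpace.proj (𝕜 := ℝ) i).lipschitz.comp hy
  have hline : ∀ i j : Fin n, (fun x => lineDeriv ℝ (fun x => y x i) x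
      (EuclideanSpace.single j 1)) =ᵐ[volume.restrict Ω] fun x => F x i j := by
    intro i j
    filter_upwards [hF] with x hx
    rw [← hasFDerivWithinAt_univ, hasFDerivWithinAt_euclidean] at hx
    have h1 := (hx i).hasFDerivAt Filter.univ_mem
    rw [(h1.hasLineDerivAt _).lineDeriv]
    simp [Matrix.toLpLin_apply]
  refine ⟨hy.continuous.memLp_of_isBounded hm hΩb _, fun i j => ?_, ?_⟩
  · refine (MemLp.of_bound ?_ _ (Filter.Eventually.of_forall fun x =>
      norm_lineDeriv_le_of_lipschitz ℝ (hyi i))).ae_eq (hline i j)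
    exact (measurable_lineDeriv (hyi i).continuous).aestronglyMeasurable
  · intro φ hφ hc hs i j
    exact ((HasWeakGradient.of_lipschitzWith (hyi i) Ω).congr (hline i)) φ hφ hc hs j

theorem extAverage_eq {n : ℕ} {Ω : Set (EuclideanSpace ℝ (Fin n))}
    {f : EuclideanSpace ℝ (Fin n) → ℝ} (h0 : volume Ω ≠ 0) (hf : IntegrableOn f Ω) :
    extAverage Ω f = ((⨍ x in Ω, f x : ℝ) : EReal) := by
  set ν := ((volume.restrict Ω) univ)⁻¹ • volume.restrict Ω with hν
  have hi : Integrable f ν := hf.smul_measure (by simpa using h0)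
  have h1 := hi.lintegral_lt_top.ne
  have h2 := hi.neg.lintegral_lt_top.ne
  rw [extAverage, average, integral_eq_lintegral_pos_part_sub_lintegral_neg_part hi, laverage,
    laverage]
  rw [EReal.coe_sub, EReal.coe_ennreal_toReal h1]
  congr 1
  exact (EReal.coe_ennreal_toReal h2).symm

/-- Lower integrals are monotone without any measurability, so an integrable minorant suffices to
bound the average of an arbitrary function. -/
theorem extAverage_mono {n : ℕ} {Ω : Set (EuclideanSpace ℝ (Fin n))}
    {f g : EuclideanSpace ℝ (Fin n) → ℝ} (h : ∀ᵐ x ∂(volume.restrict Ω), f x ≤ g x) :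
    extAverage Ω f ≤ extAverage Ω g := by
  have h' := Measure.ae_smul_measure h ((volume.restrict Ω) univ)⁻¹
  refine EReal.sub_le_sub ?_ ?_
  · rw [EReal.coe_ennreal_le_coe_ennreal_iff]
    exact lintegral_mono_ae (h'.mono fun x hx => ENNReal.ofReal_le_ofReal hx)
  · rw [EReal.coe_ennreal_le_coe_ennreal_iff]
    exact lintegral_mono_ae (h'.mono fun x hx => ENNReal.ofReal_le_ofReal (neg_le_neg hx))

theorem toEuclideanLin_det {n : ℕ} (A : Matrix (Fin n) (Fin n) ℝ) :
    LinearMap.det (Matrix.toEuclideanLin A) = A.det := by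
  simp [Matrix.toEuclideanLin_eq_toLin_orthonormal, LinearMap.det_toLin]

/-! ### Sufficiency: mean Jacobian and Jensen's inequality -/

/-- A convex function on `(0, ∞)` has a supporting line at every point. -/
theorem ConvexOn.exists_support_line_Ioi {H : ℝ → ℝ} (hH : ConvexOn ℝ (Ioi 0) H) {m : ℝ}
    (hm : 0 < m) : ∃ c : ℝ, ∀ d, 0 < d → H m + c * (d - m) ≤ H d := by
  -- The supremum of the chord slopes to the left of `m`, that is the left derivative, will be the
  -- slope of the supporting line.
  set S : Set ℝ := (fun d => (H m - H d) / (m - d)) '' Ioo 0 m with hS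
  have hle : ∀ e, m < e → ∀ s ∈ S, s ≤ (H e - H m) / (e - m) := by
    rintro e he _ ⟨d, hd, rfl⟩
    exact hH.slope_mono_adjacent hd.1 (hm.trans he) hd.2 he
  have hSne : S.Nonempty := ⟨_, m / 2, ⟨by positivity, by linarith⟩, rfl⟩
  have hSb : BddAbove S := ⟨_, hle (m + 1) (by linarith)⟩
  refine ⟨sSup S, fun d hd => ?_⟩
  rcases lt_trichotomy d m with h | rfl | h
  · have h1 : (H m - H d) / (m - d) ≤ sSup S := le_csSup hSb ⟨d, ⟨hd, h⟩, rfl⟩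
    rw [div_le_iff₀ (by linarith)] at h1
    linarith
  · simp
  · have h1 := csSup_le hSne (hle d h)
    rw [le_div_iff₀ (by linarith)] at h1
    linarith

namespace IsOrientationPreservingInvertible

variable {n : ℕ} {p : ℝ} {Ω : Set (EuclideanSpace ℝ (Fin n))} {M : Matrix (Fin n) (Fin n) ℝ}
  {y : EuclideanSpace ℝ (Fin n) → EuclideanSpace ℝ (Fin n)}
  {F : EuclideanSpace ℝ (Fin n) → Matrix (Fin n) (Fin n) ℝ}

/-- The Jacobian determinant has integral `|MΩ|`. -/
theorem integral_det (h : IsOrientationPreservingInvertible p Ω (Matrix.toEuclideanLin M '' Ω) y F)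
    (hp : 1 < p) (hnp : (n : ℝ) < p) (hΩ : IsOpen Ω) (hΩb : Bornology.IsBounded Ω)
    (hM : 0 < M.det) :
    IntegrableOn (fun x => (F x).det) Ω ∧ ∫ x in Ω, (F x).det = M.det * volume.real Ω := by
  have h1 := h.sobolev.lintegral_abs_det_eq hp hnp hΩ hΩb h.continuousOn h.bijOn.injOn
  rw [h.bijOn.image_eq, Measure.addHaar_image_linearMap, toEuclideanLin_det, abs_of_pos hM] at h1
  have h2 : ∫⁻ x in Ω, ENNReal.ofReal (F x).det = ENNReal.ofReal M.det * volume Ω := by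
    rw [← h1]
    refine lintegral_congr_ae (h.det_pos.mono fun x hx => ?_)
    simp only [abs_of_pos hx]
  have hmeas : AEStronglyMeasurable (fun x => (F x).det) (volume.restrict Ω) := by
    simp_rw [Matrix.det_apply]
    refine Finset.aestronglyMeasurable_fun_sum _ fun σ _ => AEStronglyMeasurable.const_smul ?_ _
    exact Finset.aestronglyMeasurable_fun_prod _ fun i _ =>
      (h.sobolev.memLp_gradient _ _).aestronglyMeasurable
  have hnn : 0 ≤ᵐ[volume.restrict Ω] fun x => (F x).det := h.det_pos.mono fun x hx => hx.le
  refine ⟨⟨hmeas, ?_⟩, ?_⟩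
  · rw [hasFiniteIntegral_iff_ofReal hnn, h2]
    exact ENNReal.mul_lt_top ENNReal.ofReal_lt_top hΩb.measure_lt_top
  · rw [integral_eq_lintegral_of_nonneg_ae hnn hmeas, h2, ENNReal.toReal_mul,
      ENNReal.toReal_ofReal hM.le, Measure.real]

/-- Jensen's inequality: the supporting line of `H` at det M is an integrable minorant of `Ψ (F x)`,
and its average is `Ψ M` because the Jacobian has average det M. -/
theorem le_extAverage
    (h : IsOrientationPreservingInvertible p Ω (Matrix.toEuclideanLin M '' Ω) y F)
    (hp : 1 < p) (hnp : (n : ℝ) < p) (hΩ : IsBoundedLipschitzDomain Ω) (hM : 0 < M.det)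
    {H : ℝ → ℝ} (hH : ConvexOn ℝ (Ioi 0) H) {Ψ : Matrix (Fin n) (Fin n) ℝ → ℝ}
    (hΨ : ∀ A : Matrix (Fin n) (Fin n) ℝ, 0 < A.det → Ψ A = H A.det) :
    (Ψ M : EReal) ≤ extAverage Ω fun x => Ψ (F x) := by
  obtain ⟨c, hc⟩ := hH.exists_support_line_Ioi hM
  obtain ⟨hi, hint⟩ := h.integral_det hp hnp hΩ.isOpen hΩ.isBounded hM
  have hfin : IsFiniteMeasure (volume.restrict Ω) :=
    isFiniteMeasure_restrict.2 hΩ.isBounded.measure_lt_top.ne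
  have h0 : volume Ω ≠ 0 := (hΩ.isOpen.measure_pos volume hΩ.isConnected.nonempty).ne'
  have h0' : volume.real Ω ≠ 0 :=
    (ENNReal.toReal_pos h0 hΩ.isBounded.measure_lt_top.ne).ne'
  have hci : Integrable (fun x => c * ((F x).det - M.det)) (volume.restrict Ω) :=
    (hi.sub (integrable_const _)).const_mul c
  have hli : IntegrableOn (fun x => H M.det + c * ((F x).det - M.det)) Ω :=
    (integrable_const _).add hci
  have hav : ⨍ x in Ω, (H M.det + c * ((F x).det - M.det)) = Ψ M := by
    rw [setAverage_eq, integral_add (integrable_const _) hci, integral_const_mul,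
      integral_sub hi (integrable_const _), hint, integral_const, integral_const,
      measureReal_restrict_apply_univ, hΨ M hM]
    simp only [smul_eq_mul]
    field_simp
    ring
  rw [← hav, ← extAverage_eq h0 hli]
  refine extAverage_mono (h.det_pos.mono fun x hx => ?_)
  rw [hΨ _ hx]
  exact hc _ hx

end IsOrientationPreservingInvertible

/-! ### Linear and bi-Lipschitz maps as competitors -/

theorem toEuclideanLin_mul_apply {n : ℕ} (A B : Matrix (Fin n) (Fin n) ℝ)
    (x : EuclideanSpace ℝ (Fin n)) :
    Matrix.toEuclideanLin (A * B) x = Matrix.toEuclideanLin A (Matrix.toEuclideanLin B x) := by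
  simp [Matrix.toLpLin_apply, Matrix.mulVec_mulVec]

theorem toEuclideanLin_one_apply {n : ℕ} (x : EuclideanSpace ℝ (Fin n)) :
    Matrix.toEuclideanLin (1 : Matrix (Fin n) (Fin n) ℝ) x = x := by
  simp

theorem continuous_toEuclideanLin {n : ℕ} (A : Matrix (Fin n) (Fin n) ℝ) :
    Continuous (Matrix.toEuclideanLin A) :=
  (LinearMap.toContinuousLinearMap (Matrix.toEuclideanLin A)).continuous

theorem lipschitzWith_toEuclideanLin {n : ℕ} (A : Matrix (Fin n) (Fin n) ℝ) :
    LipschitzWith ‖LinearMap.toContinuousLinearMap (Matrix.toEuclideanLin A)‖₊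
      (Matrix.toEuclideanLin A) :=
  (LinearMap.toContinuousLinearMap (Matrix.toEuclideanLin A)).lipschitz

theorem toEuclideanLin_inv_leftInverse {n : ℕ} {A : Matrix (Fin n) (Fin n) ℝ} (hA : A.det ≠ 0) :
    Function.LeftInverse (Matrix.toEuclideanLin A⁻¹) (Matrix.toEuclideanLin A) := fun x => by
  rw [← toEuclideanLin_mul_apply, Matrix.nonsing_inv_mul _ (isUnit_iff_ne_zero.2 hA),
    toEuclideanLin_one_apply]

theorem toEuclideanLin_inv_rightInverse {n : ℕ} {A : Matrix (Fin n) (Fin n) ℝ} (hA : A.det ≠ 0) :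
    Function.RightInverse (Matrix.toEuclideanLin A⁻¹) (Matrix.toEuclideanLin A) := fun x => by
  rw [← toEuclideanLin_mul_apply, Matrix.mul_nonsing_inv _ (isUnit_iff_ne_zero.2 hA),
    toEuclideanLin_one_apply]

theorem isOpen_image_toEuclideanLin {n : ℕ} {A : Matrix (Fin n) (Fin n) ℝ} (hA : A.det ≠ 0)
    {Ω : Set (EuclideanSpace ℝ (Fin n))} (hΩ : IsOpen Ω) :
    IsOpen (Matrix.toEuclideanLin A '' Ω) := by
  rw [image_eq_preimage_of_inverse (toEuclideanLin_inv_leftInverse hA)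
    (toEuclideanLin_inv_rightInverse hA)]
  exact hΩ.preimage (continuous_toEuclideanLin _)

/-- A bi-Lipschitz map with positive Jacobian is orientation-preserving and invertible. -/
theorem isOrientationPreservingInvertible_of_lipschitzWith {n : ℕ} (p : ℝ)
    {Ω₁ Ω₂ : Set (EuclideanSpace ℝ (Fin n))} (hm₁ : MeasurableSet Ω₁) (hm₂ : MeasurableSet Ω₂)
    (hb₁ : Bornology.IsBounded Ω₁) (hb₂ : Bornology.IsBounded Ω₂)
    {y z : EuclideanSpace ℝ (Fin n) → EuclideanSpace ℝ (Fin n)}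
    {F G : EuclideanSpace ℝ (Fin n) → Matrix (Fin n) (Fin n) ℝ} {K K' : NNReal}
    (hy : LipschitzWith K y) (hz : LipschitzWith K' z) (hbij : BijOn y Ω₁ Ω₂)
    (hinv : InvOn z y Ω₁ Ω₂)
    (hF : ∀ᵐ x ∂(volume.restrict Ω₁),
      HasFDerivAt y (LinearMap.toContinuousLinearMap (Matrix.toEuclideanLin (F x))) x)
    (hG : ∀ᵐ x ∂(volume.restrict Ω₂),
      HasFDerivAt z (LinearMap.toContinuousLinearMap (Matrix.toEuclideanLin (G x))) x)
    (hdet : ∀ᵐ x ∂(volume.restrict Ω₁), 0 < (F x).det) :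
    IsOrientationPreservingInvertible p Ω₁ Ω₂ y F where
  continuousOn := hy.continuous.continuousOn
  bijOn := hbij
  sobolev := hasSobolevGradient_of_lipschitzWith p hm₁ hb₁ hy hF
  inverse := ⟨z, G, hinv, hz.continuous.continuousOn,
    hasSobolevGradient_of_lipschitzWith p hm₂ hb₂ hz hG⟩
  det_pos := hdet

theorem isOrientationPreservingInvertible_toEuclideanLin {n : ℕ} (p : ℝ)
    {Ω : Set (EuclideanSpace ℝ (Fin n))} (hΩ : IsOpen Ω) (hΩb : Bornology.IsBounded Ω)
    {A : Matrix (Fin n) (Fin n) ℝ} (hA : 0 < A.det) :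
    IsOrientationPreservingInvertible p Ω (Matrix.toEuclideanLin A '' Ω)
      (Matrix.toEuclideanLin A) fun _ => A :=
  isOrientationPreservingInvertible_of_lipschitzWith p hΩ.measurableSet
    (isOpen_image_toEuclideanLin hA.ne' hΩ).measurableSet hΩb
    ((lipschitzWith_toEuclideanLin A).isBounded_image hΩb) (lipschitzWith_toEuclideanLin A)
    (lipschitzWith_toEuclideanLin A⁻¹)
    (toEuclideanLin_inv_leftInverse hA.ne').injective.injOn.bijOn_image
    ⟨(toEuclideanLin_inv_leftInverse hA.ne').leftInvOn _,
      (toEuclideanLin_inv_rightInverse hA.ne').rightInvOn _⟩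
    (Filter.Eventually.of_forall fun _ => ContinuousLinearMap.hasFDerivAt
      (LinearMap.toContinuousLinearMap (Matrix.toEuclideanLin A)))
    (G := fun _ => A⁻¹) (Filter.Eventually.of_forall fun _ => ContinuousLinearMap.hasFDerivAt
      (LinearMap.toContinuousLinearMap (Matrix.toEuclideanLin A⁻¹)))
    (Filter.Eventually.of_forall fun _ => hA)

/-! ### Necessity: invariance of Ψ under matrices of finite order -/

/-- The average of `Ψ (Dy)` over a bounded Lipschitz domain is at least `Ψ M`, for every
orientation-preserving invertible `y` with the same image as `M`. -/
def IsBelowAverages {n : ℕ} (p : ℝ) (Ψ : Matrix (Fin n) (Fin n) ℝ → ℝ) : Prop :=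
  ∀ (Ω : Set (EuclideanSpace ℝ (Fin n))) (M : Matrix (Fin n) (Fin n) ℝ)
    (y : EuclideanSpace ℝ (Fin n) → EuclideanSpace ℝ (Fin n))
    (F : EuclideanSpace ℝ (Fin n) → Matrix (Fin n) (Fin n) ℝ),
    IsBoundedLipschitzDomain Ω → 0 < M.det →
    IsOrientationPreservingInvertible p Ω (Matrix.toEuclideanLin M '' Ω) y F →
    (Ψ M : EReal) ≤ extAverage Ω (fun x => Ψ (F x))

/-- `S` has determinant one and `Ψ` is invariant under multiplication by `S` on the right. -/
def IsRightInvariant {n : ℕ} (Ψ : Matrix (Fin n) (Fin n) ℝ → ℝ)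
    (S : Matrix (Fin n) (Fin n) ℝ) : Prop :=
  S.det = 1 ∧ ∀ B : Matrix (Fin n) (Fin n) ℝ, 0 < B.det → Ψ (B * S) = Ψ B

theorem IsRightInvariant.mul {n : ℕ} {Ψ : Matrix (Fin n) (Fin n) ℝ → ℝ}
    {S T : Matrix (Fin n) (Fin n) ℝ} (hS : IsRightInvariant Ψ S) (hT : IsRightInvariant Ψ T) :
    IsRightInvariant Ψ (S * T) :=
  ⟨by rw [Matrix.det_mul, hS.1, hT.1, one_mul], fun B hB => by
    rw [← mul_assoc, hT.2 _ (by rwa [Matrix.det_mul, hS.1, mul_one]), hS.2 B hB]⟩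

theorem IsRightInvariant.one {n : ℕ} (Ψ : Matrix (Fin n) (Fin n) ℝ → ℝ) :
    IsRightInvariant Ψ 1 :=
  ⟨Matrix.det_one, fun B _ => by rw [mul_one]⟩

/-- A matrix of finite order leaves some bounded Lipschitz domain invariant. -/
theorem exists_isBoundedLipschitzDomain_image_eq {n : ℕ} {S : Matrix (Fin n) (Fin n) ℝ} {k : ℕ}
    (hk : 0 < k) (hS : S ^ k = 1) : ∃ Ω : Set (EuclideanSpace ℝ (Fin n)),
      IsBoundedLipschitzDomain Ω ∧ Matrix.toEuclideanLin S '' Ω = Ω := by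
  -- Summing the norm over the cyclic group generated by `S` gives an `S`-invariant norm; its open
  -- unit ball is the domain.
  set N : EuclideanSpace ℝ (Fin n) → ℝ :=
    fun x => ∑ i ∈ Finset.range k, ‖Matrix.toEuclideanLin (S ^ i) x‖ with hN
  have hNc : Continuous N := by
    have := fun i => continuous_toEuclideanLin (S ^ i)
    fun_prop
  have hconv : ConvexOn ℝ univ N := by
    refine ⟨convex_univ, fun x _ x' _ a b ha hb _ => ?_⟩
    simp only [hN, Finset.smul_sum, ← Finset.sum_add_distrib]
    refine Finset.sum_le_sum fun i _ => ?_
    rw [map_add, map_smul, map_smul]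
    refine (norm_add_le _ _).trans ?_
    rw [norm_smul, norm_smul, Real.norm_of_nonneg ha, Real.norm_of_nonneg hb, smul_eq_mul,
      smul_eq_mul]
  have hle : ∀ x, ‖x‖ ≤ N x := fun x => by
    have := Finset.single_le_sum (f := fun i => ‖Matrix.toEuclideanLin (S ^ i) x‖)
      (fun i _ => norm_nonneg _) (Finset.mem_range.2 hk)
    rwa [pow_zero, toEuclideanLin_one_apply] at this
  have hinv : ∀ x, N (Matrix.toEuclideanLin S x) = N x := fun x => by
    obtain ⟨m, rfl⟩ := Nat.exists_eq_succ_of_ne_zero hk.ne'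
    simp only [hN]
    simp_rw [← toEuclideanLin_mul_apply, ← pow_succ]
    rw [Finset.sum_range_succ, Finset.sum_range_succ']
    rw [show S ^ (m + 1) = 1 from hS, pow_zero]
  have hSdet : S.det ≠ 0 := fun h => by
    have := congrArg Matrix.det hS
    rw [Matrix.det_pow, h, zero_pow hk.ne', Matrix.det_one] at this
    exact zero_ne_one this
  refine ⟨{x | N x < 1}, isBoundedLipschitzDomain_of_convex (isOpen_lt hNc continuous_const)
    (by simpa using hconv.convex_lt 1) ?_ ⟨0, by simp [hN]⟩, ?_⟩
  · refine (Metric.isBounded_ball (x := 0) (r := 1)).subset fun x hx => ?_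
    rw [mem_ball_zero_iff]
    exact (hle x).trans_lt hx
  · rw [image_eq_preimage_of_inverse (toEuclideanLin_inv_leftInverse hSdet)
      (toEuclideanLin_inv_rightInverse hSdet)]
    ext x
    change N _ < 1 ↔ N x < 1
    rw [← hinv (Matrix.toEuclideanLin S⁻¹ x), toEuclideanLin_inv_rightInverse hSdet]

theorem extAverage_const {n : ℕ} {Ω : Set (EuclideanSpace ℝ (Fin n))}
    (hΩ : IsBoundedLipschitzDomain Ω) (c : ℝ) : extAverage Ω (fun _ => c) = c := by
  have : IsFiniteMeasure (volume.restrict Ω) :=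
    isFiniteMeasure_restrict.2 hΩ.isBounded.measure_lt_top.ne
  have h0 : volume Ω ≠ 0 := (hΩ.isOpen.measure_pos volume hΩ.isConnected.nonempty).ne'
  rw [extAverage_eq h0 (integrable_const c), setAverage_const h0 hΩ.isBounded.measure_lt_top.ne]

namespace IsBelowAverages

variable {n : ℕ} {p : ℝ} {Ψ : Matrix (Fin n) (Fin n) ℝ → ℝ}

/-- On a domain with SΩ = Ω, the linear map `B * S` has the same image as `B` and constant gradient,
so the average is just `Ψ (B * S)`. -/
theorem le_mul (h : IsBelowAverages p Ψ) {S : Matrix (Fin n) (Fin n) ℝ} {k : ℕ} (hk : 0 < k)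
    (hS : S ^ k = 1) (hdet : S.det = 1) {B : Matrix (Fin n) (Fin n) ℝ} (hB : 0 < B.det) :
    Ψ B ≤ Ψ (B * S) := by
  obtain ⟨Ω, hΩ, hSΩ⟩ := exists_isBoundedLipschitzDomain_image_eq hk hS
  have h1 := isOrientationPreservingInvertible_toEuclideanLin p hΩ.isOpen hΩ.isBounded
    (A := B * S) (by rwa [Matrix.det_mul, hdet, mul_one])
  have h2 : Matrix.toEuclideanLin (B * S) '' Ω = Matrix.toEuclideanLin B '' Ω := by
    conv_rhs => rw [← hSΩ, image_image]
    simp_rw [toEuclideanLin_mul_apply]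
  rw [h2] at h1
  have h3 := h Ω B _ _ hΩ hB h1
  rwa [extAverage_const hΩ, EReal.coe_le_coe_iff] at h3

theorem isRightInvariant_of_pow_eq_one (h : IsBelowAverages p Ψ) {S : Matrix (Fin n) (Fin n) ℝ}
    {k : ℕ} (hk : 0 < k) (hS : S ^ k = 1) (hdet : S.det = 1) : IsRightInvariant Ψ S := by
  refine ⟨hdet, fun B hB => le_antisymm ?_ (h.le_mul hk hS hdet hB)⟩
  -- S^(k-1) is the inverse of `S`, so this is the opposite inequality.
  have h1 := h.le_mul hk (S := S ^ (k - 1)) (by rw [← pow_mul, mul_comm, pow_mul, hS, one_pow])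
    (by rw [Matrix.det_pow, hdet, one_pow]) (B := B * S) (by rwa [Matrix.det_mul, hdet, mul_one])
  rwa [mul_assoc, ← pow_succ', Nat.sub_add_cancel hk, hS, mul_one] at h1

end IsBelowAverages

/-! ### Relations of SL(2, ℤ) in an arbitrary ring -/

section Relations

variable {R : Type*} [Ring R] {a b : R}

theorem one_add_mul_one_add_mul_one_add (haa : a * a = 0) (haba : a * (b * a) = -a) :
    (1 + a) * (1 + b) * (1 + a) = 1 + a + b + (a * b + b * a) := by
  simp only [mul_add, add_mul, mul_assoc, one_mul, mul_one, haa, haba]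
  abel

/-- Here -(ab + ba) is an idempotent, the projection to a coordinate plane in the application, so
the element is a reflection through it: -1 on the plane and 1 on the complement. It is the cube of
(1 + a)(1 + b) and the square of (1 + a)(1 + b)(1 + a), which gives these the exponents 6 and 4. -/
theorem one_add_two_nsmul_sq (haa : a * a = 0) (hbb : b * b = 0)
    (haba : a * (b * a) = -a) (hbab : b * (a * b) = -b) :
    (1 + (a * b + b * a) + (a * b + b * a)) ^ 2 = 1 := by
  have h1 : ∀ x, a * (a * x) = 0 := fun x => by rw [← mul_assoc, haa, zero_mul]
  have h2 : ∀ x, b * (b * x) = 0 := fun x => by rw [← mul_assoc, hbb, zero_mul]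
  rw [pow_two]
  simp only [mul_add, add_mul, mul_assoc, one_mul, mul_one, haba, hbab, h1, h2, mul_neg, mul_zero]
  abel

theorem one_add_mul_one_add_pow_six (haa : a * a = 0) (hbb : b * b = 0)
    (haba : a * (b * a) = -a) (hbab : b * (a * b) = -b) : ((1 + a) * (1 + b)) ^ 6 = 1 := by
  have h1 : ∀ x, a * (a * x) = 0 := fun x => by rw [← mul_assoc, haa, zero_mul]
  have e1 : ((1 + a) * (1 + b)) ^ 2 = 1 + a + b + a * b + a * b + b * a := by
    rw [pow_two]
    simp only [mul_add, add_mul, mul_assoc, one_mul, mul_one, haa, hbb, haba, hbab, h1, mul_neg,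
      mul_zero]
    abel
  have e2 : ((1 + a) * (1 + b)) ^ 3 = 1 + (a * b + b * a) + (a * b + b * a) := by
    rw [pow_succ, e1]
    simp only [mul_add, add_mul, mul_assoc, one_mul, mul_one, haa, hbb, haba, hbab, h1, mul_neg,
      mul_zero]
    abel
  rw [show 6 = 3 * 2 from rfl, pow_mul, e2, one_add_two_nsmul_sq haa hbb haba hbab]

theorem one_add_mul_one_add_mul_one_add_pow_four (haa : a * a = 0) (hbb : b * b = 0)
    (haba : a * (b * a) = -a) (hbab : b * (a * b) = -b) :
    ((1 + a) * (1 + b) * (1 + a)) ^ 4 = 1 := by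
  have h1 : ∀ x, a * (a * x) = 0 := fun x => by rw [← mul_assoc, haa, zero_mul]
  have h2 : ∀ x, b * (b * x) = 0 := fun x => by rw [← mul_assoc, hbb, zero_mul]
  have e1 : ((1 + a) * (1 + b) * (1 + a)) ^ 2 = 1 + (a * b + b * a) + (a * b + b * a) := by
    rw [one_add_mul_one_add_mul_one_add haa haba, pow_two]
    simp only [mul_add, add_mul, mul_assoc, one_mul, mul_one, haa, hbb, haba, hbab, h1, h2,
      mul_neg, mul_zero]
    abel
  rw [show 4 = 2 * 2 from rfl, pow_mul, e1, one_add_two_nsmul_sq haa hbb haba hbab]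

end Relations

/-! ### Matrices of finite order generate SL(n, ℝ) -/

namespace IsBelowAverages

variable {n : ℕ} {p : ℝ} {Ψ : Matrix (Fin n) (Fin n) ℝ → ℝ}

/-- The matrix of `(x_i, x_j) ↦ (-t x_j, t⁻¹ x_i)`, which has order four. -/
theorem isRightInvariant_quarterTurn (h : IsBelowAverages p Ψ) {i j : Fin n} (hij : i ≠ j) {t : ℝ}
    (ht : t ≠ 0) : IsRightInvariant Ψ (Matrix.transvection i j (-t) *
      Matrix.transvection j i t⁻¹ * Matrix.transvection i j (-t)) := by
  refine h.isRightInvariant_of_pow_eq_one (k := 4) (by norm_num)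
    (one_add_mul_one_add_mul_one_add_pow_four ?_ ?_ ?_ ?_) (by
      simp [Matrix.det_mul, Matrix.det_transvection_of_ne, hij, hij.symm])
  · simp [hij.symm]
  · simp [hij]
  · simp [ht, Matrix.single_neg]
  · simp [ht, Matrix.single_neg]

/-- A transvection has infinite order unless t = 0, but it is a product of two matrices of finite
order: with W = (1 + a)(1 + b) of order dividing 6, W⁵ · W(1 + a) = 1 + a, and W(1 + a) is a quarter
turn. -/
theorem isRightInvariant_transvection (h : IsBelowAverages p Ψ) {i j : Fin n} (hij : i ≠ j)
    (t : ℝ) : IsRightInvariant Ψ (Matrix.transvection i j t) := by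
  rcases eq_or_ne t 0 with rfl | ht
  · rw [Matrix.transvection_zero]; exact IsRightInvariant.one Ψ
  have ht' : -t ≠ 0 := neg_ne_zero.2 ht
  set W := Matrix.transvection i j (- -t) * Matrix.transvection j i (-t)⁻¹ with hW
  have h6 : W ^ 6 = 1 := by
    refine one_add_mul_one_add_pow_six ?_ ?_ ?_ ?_
    · simp [hij.symm]
    · simp [hij]
    · simp [ht, Matrix.single_neg]
    · simp [ht, Matrix.single_neg]
  have hdet : W.det = 1 := by
    simp [hW, Matrix.det_mul, Matrix.det_transvection_of_ne, hij, hij.symm]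
  have h5 : IsRightInvariant Ψ (W ^ 5) :=
    h.isRightInvariant_of_pow_eq_one (k := 6) (by norm_num)
      (by rw [← pow_mul, mul_comm, pow_mul, h6, one_pow])
      (by rw [Matrix.det_pow, hdet, one_pow])
  have := h5.mul (h.isRightInvariant_quarterTurn hij ht')
  rwa [← mul_assoc, ← pow_succ, h6, one_mul, neg_neg] at this

theorem isRightInvariant_diagonal_pair (h : IsBelowAverages p Ψ) {i j : Fin n} (hij : i ≠ j)
    {c : ℝ} (hc : c ≠ 0) : IsRightInvariant Ψ
      (Matrix.diagonal fun k => if k = i then c else if k = j then c⁻¹ else 1) := by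
  have hE : ∀ t : ℝ, t ≠ 0 → Matrix.transvection i j (-t) *
      Matrix.transvection j i t⁻¹ * Matrix.transvection i j (-t) =
      1 + Matrix.single i j (-t) + Matrix.single j i t⁻¹
        - (Matrix.single i i 1 + Matrix.single j j 1) := by
    intro t ht
    simp only [Matrix.transvection]
    rw [one_add_mul_one_add_mul_one_add (by simp [hij.symm]) (by simp [ht, Matrix.single_neg])]
    simp only [Matrix.single_mul_single_same]
    rw [neg_mul, mul_neg, mul_inv_cancel₀ ht, inv_mul_cancel₀ ht, sub_eq_add_neg, neg_add,
      Matrix.single_neg, Matrix.single_neg]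
  -- In the (i, j) plane the product of the quarter turns with parameters -c and 1 is diag(c, c⁻¹).
  have := (h.isRightInvariant_quarterTurn hij (neg_ne_zero.2 hc)).mul
    (h.isRightInvariant_quarterTurn hij one_ne_zero)
  rw [hE _ (neg_ne_zero.2 hc), hE _ one_ne_zero] at this
  convert this using 1
  have hji := hij.symm
  simp only [sub_mul, add_mul, mul_sub, mul_add, one_mul, mul_one, Matrix.single_mul_single_same,
    ne_eq, hij, hji, not_false_eq_true, Matrix.single_mul_single_of_ne]
  ext k l
  simp only [Matrix.diagonal_apply, Matrix.add_apply, Matrix.sub_apply, Matrix.one_apply,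
    Matrix.single_apply]
  by_cases hkl : k = l
  · subst hkl
    by_cases hki : k = i
    · subst hki
      simp [hji]
    · by_cases hkj : k = j
      · subst hkj
        simp [hij, hji, inv_neg]
      · simp [hki, hkj, Ne.symm hki, Ne.symm hkj]
  · grind

theorem isRightInvariant_diagonal (h : IsBelowAverages p Ψ) {d : Fin n → ℝ}
    (hd : (Matrix.diagonal d).det = 1) : IsRightInvariant Ψ (Matrix.diagonal d) := by
  rcases isEmpty_or_nonempty (Fin n) with he | ⟨⟨i₀⟩⟩
  · rw [Subsingleton.elim (Matrix.diagonal d) 1]; exact IsRightInvariant.one Ψ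
  rw [Matrix.det_diagonal] at hd
  have hd0 : ∀ i, d i ≠ 0 := fun i hi => by
    rw [Finset.prod_eq_zero (Finset.mem_univ i) hi] at hd
    exact zero_ne_one hd
  -- The entries are installed one at a time by pairs (i, i₀); entry i₀ absorbs the inverses. Once
  -- all other entries are in place, determinant one forces the entry at i₀ to be `d i₀`.
  have key : ∀ s : Finset (Fin n), i₀ ∉ s → IsRightInvariant Ψ (Matrix.diagonal fun k =>
      if k = i₀ then (∏ j ∈ s, d j)⁻¹ else if k ∈ s then d k else 1) := by
    intro s
    induction s using Finset.induction_on with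
    | empty =>
      intro _
      convert IsRightInvariant.one Ψ
      rw [← Matrix.diagonal_one]
      congr 1; ext k; simp
    | insert i s his ih =>
      intro hi₀
      rw [Finset.mem_insert, not_or] at hi₀
      convert (ih hi₀.2).mul (h.isRightInvariant_diagonal_pair (Ne.symm hi₀.1) (hd0 i)) using 1
      rw [Matrix.diagonal_mul_diagonal]
      congr 1; ext k
      by_cases hk : k = i₀
      · subst hk
        simp [hi₀.1, Finset.prod_insert his, mul_comm]
      · by_cases hki : k = i
        · subst hki; simp [hk, his]
        · simp [hk, hki]
  have := key (Finset.univ.erase i₀) (by simp)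
  convert this using 2
  ext k
  by_cases hk : k = i₀
  · subst hk
    rw [← Finset.mul_prod_erase _ _ (Finset.mem_univ k)] at hd
    simpa using eq_inv_of_mul_eq_one_left hd
  · simp [hk]

/-- Gaussian elimination: a matrix is a product of transvections and a diagonal matrix of the same
determinant. -/
theorem isRightInvariant (h : IsBelowAverages p Ψ) {S : Matrix (Fin n) (Fin n) ℝ}
    (hS : S.det = 1) : IsRightInvariant Ψ S :=
  Matrix.diagonal_transvection_induction (IsRightInvariant Ψ) S
    (fun _ hd => h.isRightInvariant_diagonal (hd.trans hS))
    (fun t => h.isRightInvariant_transvection t.hij t.c) fun _ _ hA hB => hA.mul hB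

theorem eq_of_det_eq (h : IsBelowAverages p Ψ) {A B : Matrix (Fin n) (Fin n) ℝ}
    (hB : 0 < B.det) (hAB : A.det = B.det) : Ψ A = Ψ B := by
  have hu : IsUnit B.det := isUnit_iff_ne_zero.2 hB.ne'
  have := (h.isRightInvariant (S := B⁻¹ * A) (by
    rw [Matrix.det_mul, hAB, Matrix.det_nonsing_inv, Ring.inverse_mul_cancel _ hu])).2 B hB
  rwa [← mul_assoc, Matrix.mul_nonsing_inv _ hu, one_mul] at this

end IsBelowAverages

/-! ### Necessity: convexity, by piecewise linear stretches of a cube -/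

/-- The piecewise linear function vanishing at `0` with slope `a` below `c` and `b` above `c`,
where `c ≥ 0`. -/
noncomputable def stretch (a b c t : ℝ) : ℝ := a * min t c + b * max (t - c) 0

theorem stretch_of_le {a b c t : ℝ} (h : t ≤ c) : stretch a b c t = a * t := by
  rw [stretch, min_eq_left h, max_eq_right (by linarith)]; ring

theorem stretch_of_ge {a b c t : ℝ} (h : c ≤ t) : stretch a b c t = a * c + b * (t - c) := by
  rw [stretch, min_eq_right h, max_eq_left (by linarith)]

theorem stretch_strictMono {a b : ℝ} (ha : 0 < a) (hb : 0 < b) (c : ℝ) :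
    StrictMono (stretch a b c) := by
  intro t s hts
  rcases le_total s c with hs | hs
  · rw [stretch_of_le hs, stretch_of_le (hts.le.trans hs)]
    exact mul_lt_mul_of_pos_left hts ha
  · rw [stretch_of_ge hs]
    rcases le_total t c with ht | ht
    · rw [stretch_of_le ht]
      rcases ht.eq_or_lt with rfl | ht
      · nlinarith
      · nlinarith [mul_nonneg hb.le (sub_nonneg.2 hs)]
    · rw [stretch_of_ge ht]
      nlinarith

/-- The inverse is again a `stretch`, with inverse slopes and the break at the image `a * c` of `c`;
Lipschitz bounds and gradients of the inverse map therefore come for free. -/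
theorem stretch_stretch {a b : ℝ} (ha : 0 < a) (hb : 0 < b) (c t : ℝ) :
    stretch a⁻¹ b⁻¹ (a * c) (stretch a b c t) = t := by
  rcases le_total t c with h | h
  · rw [stretch_of_le h, stretch_of_le (by gcongr)]
    field_simp
  · rw [stretch_of_ge h, stretch_of_ge (by nlinarith)]
    field_simp
    ring

theorem exists_lipschitzWith_stretch (a b c : ℝ) : ∃ K, LipschitzWith K (stretch a b c) :=
  ⟨_, ((lipschitzWith_smul a).comp (LipschitzWith.id.min_const c)).add
    ((lipschitzWith_smul b).comp
      ((LipschitzWith.id.sub (LipschitzWith.const c)).max_const 0))⟩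

theorem hasDerivAt_stretch {a b c t : ℝ} (h : t ≠ c) :
    HasDerivAt (stretch a b c) (if t < c then a else b) t := by
  rcases lt_or_gt_of_ne h with h | h
  · rw [if_pos h]
    refine (((hasDerivAt_id t).const_mul a).congr_deriv (mul_one a)).congr_of_eventuallyEq ?_
    filter_upwards [Iio_mem_nhds h] with s hs
    exact stretch_of_le hs.le
  · rw [if_neg h.not_gt]
    refine (((((hasDerivAt_id t).sub_const c).const_mul b).const_add (a * c)).congr_deriv
      (mul_one b)).congr_of_eventuallyEq ?_
    filter_upwards [Ioi_mem_nhds h] with s hs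
    exact stretch_of_ge (le_of_lt hs)

section Box

variable {n : ℕ}

/-- The map applying `stretch` to the `i`-th coordinate. -/
noncomputable def coordStretch (i : Fin n) (a b c : ℝ) (x : EuclideanSpace ℝ (Fin n)) :
    EuclideanSpace ℝ (Fin n) :=
  x + (stretch a b c (x i) - x i) • EuclideanSpace.single i 1

theorem coordStretch_apply_self (i : Fin n) (a b c : ℝ) (x : EuclideanSpace ℝ (Fin n)) :
    coordStretch i a b c x i = stretch a b c (x i) := by
  simp [coordStretch]

theorem coordStretch_apply_of_ne {i k : Fin n} (h : k ≠ i) (a b c : ℝ)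
    (x : EuclideanSpace ℝ (Fin n)) : coordStretch i a b c x k = x k := by
  simp [coordStretch, h]

theorem coordStretch_coordStretch {a b : ℝ} (ha : 0 < a) (hb : 0 < b) (i : Fin n) (c : ℝ)
    (x : EuclideanSpace ℝ (Fin n)) :
    coordStretch i a⁻¹ b⁻¹ (a * c) (coordStretch i a b c x) = x := by
  ext k
  by_cases hk : k = i
  · subst hk
    rw [coordStretch_apply_self, coordStretch_apply_self, stretch_stretch ha hb]
  · rw [coordStretch_apply_of_ne hk, coordStretch_apply_of_ne hk]

theorem exists_lipschitzWith_coordStretch (i : Fin n) (a b c : ℝ) :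
    ∃ K, LipschitzWith K (coordStretch i a b c) := by
  obtain ⟨K, hK⟩ := exists_lipschitzWith_stretch a b c
  have hp : LipschitzWith _ fun x : EuclideanSpace ℝ (Fin n) => x i :=
    (EuclideanSpace.proj (𝕜 := ℝ) i).lipschitz
  exact ⟨_, LipschitzWith.id.add ((ContinuousLinearMap.toSpanSingleton ℝ
    (EuclideanSpace.single i (1 : ℝ))).lipschitz.comp ((hK.comp hp).sub hp))⟩

/-- The diagonal matrix with `i`-th entry `a` and all others `1`. -/
def dilation (i : Fin n) (a : ℝ) : Matrix (Fin n) (Fin n) ℝ :=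
  Matrix.diagonal fun k => if k = i then a else 1

theorem det_dilation (i : Fin n) (a : ℝ) : (dilation i a).det = a := by
  simp [dilation, Matrix.det_diagonal]

theorem hasFDerivAt_coordStretch {i : Fin n} {a b c : ℝ} {x : EuclideanSpace ℝ (Fin n)}
    (hx : x i ≠ c) : HasFDerivAt (coordStretch i a b c) (LinearMap.toContinuousLinearMap
      (Matrix.toEuclideanLin (dilation i (if x i < c then a else b)))) x := by
  have hp : HasFDerivAt (fun x : EuclideanSpace ℝ (Fin n) => x i)
      (EuclideanSpace.proj (𝕜 := ℝ) i) x := (EuclideanSpace.proj (𝕜 := ℝ) i).hasFDerivAt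
  have h1 := (((hasDerivAt_stretch (a := a) (b := b) hx).comp_hasFDerivAt x hp).sub hp).smul_const
    (EuclideanSpace.single i (1 : ℝ))
  refine ((hasFDerivAt_id x).add h1).congr_fderiv ?_
  ext v k
  by_cases hk : k = i
  · subst hk
    simp only [dilation]
    split_ifs <;> simp [Matrix.toLpLin_apply, Matrix.mulVec_diagonal]
  · simp [dilation, Matrix.toLpLin_apply, Matrix.mulVec_diagonal, hk]

theorem ae_apply_ne (i : Fin n) (c : ℝ) :
    ∀ᵐ x : EuclideanSpace ℝ (Fin n), x i ≠ c := by
  have h : ∀ᵐ x : Fin n → ℝ, x i ≠ c := by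
    rw [ae_iff, volume_pi]
    simpa using Measure.pi_hyperplane (fun _ : Fin n => (volume : Measure ℝ)) i c
  exact (PiLp.volume_preserving_ofLp (Fin n)).quasiMeasurePreserving.ae h

/-- The box with `i`-th side `(0, c)` and all others `(0, 1)`. -/
def box (i : Fin n) (c : ℝ) : Set (EuclideanSpace ℝ (Fin n)) :=
  {x | ∀ k, x k ∈ Ioo 0 (if k = i then c else 1)}

theorem box_eq_preimage (i : Fin n) (c : ℝ) : box i c = WithLp.ofLp ⁻¹'
    (univ.pi fun k => Ioo (0 : ℝ) (if k = i then c else 1)) := by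
  ext x; simp [box]

theorem isOpen_box (i : Fin n) (c : ℝ) : IsOpen (box i c) := by
  rw [box_eq_preimage]
  exact (isOpen_set_pi finite_univ fun k _ => isOpen_Ioo).preimage (PiLp.continuous_ofLp 2 _)

theorem convex_box (i : Fin n) (c : ℝ) : Convex ℝ (box i c) := by
  intro x hx x' hx' a b ha hb hab k
  simpa using convex_Ioo (0 : ℝ) _ (hx k) (hx' k) ha hb hab

theorem volume_real_box (i : Fin n) {c : ℝ} (hc : 0 ≤ c) : volume.real (box i c) = c := by
  rw [box_eq_preimage, Measure.real, (PiLp.volume_preserving_ofLp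
    (Fin n)).measure_preimage (MeasurableSet.univ_pi fun k => measurableSet_Ioo).nullMeasurableSet,
    Real.volume_pi_Ioo, ENNReal.toReal_prod]
  rw [Finset.prod_eq_single i]
  · simp [hc]
  · intro k _ hk
    simp [hk]
  · simp

theorem isBounded_box (i : Fin n) (c : ℝ) : Bornology.IsBounded (box i c) := by
  rw [box_eq_preimage]
  exact (PiLp.antilipschitzWith_ofLp 2 _).isBounded_preimage
    (Bornology.IsBounded.pi fun k => Metric.isBounded_Ioo _ _)

theorem isBoundedLipschitzDomain_box (i : Fin n) {c : ℝ} (hc : 0 < c) :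
    IsBoundedLipschitzDomain (box i c) :=
  isBoundedLipschitzDomain_of_convex (isOpen_box i c) (convex_box i c) (isBounded_box i c)
    ⟨WithLp.toLp 2 fun k => if k = i then c / 2 else 1 / 2, fun k => by
      by_cases hk : k = i
      · simp [hk, hc]
      · simp [hk]; norm_num⟩

theorem image_dilation_box (i : Fin n) {c : ℝ} (hc : 0 < c) :
    Matrix.toEuclideanLin (dilation i c) '' box i 1 = box i c := by
  have hap : ∀ (d : ℝ) (x : EuclideanSpace ℝ (Fin n)) k,
      Matrix.toEuclideanLin (dilation i d) x k = (if k = i then d else 1) * x k := fun d x k => by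
    simp [dilation, Matrix.toLpLin_apply, Matrix.mulVec_diagonal]
  ext x
  constructor
  · rintro ⟨z, hz, rfl⟩ k
    have := hz k
    rw [hap]
    by_cases hk : k = i
    · simp only [hk, if_true, mem_Ioo] at this ⊢
      exact ⟨mul_pos hc this.1, by nlinarith⟩
    · simpa [hk] using this
  · intro hx
    refine ⟨Matrix.toEuclideanLin (dilation i c⁻¹) x, fun k => ?_, ?_⟩
    · have := hx k
      rw [hap]
      by_cases hk : k = i
      · simp only [hk, if_true, mem_Ioo] at this ⊢
        rw [inv_mul_lt_iff₀ hc, mul_one]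
        exact ⟨mul_pos (inv_pos.2 hc) this.1, this.2⟩
      · simpa [hk] using this
    · ext k
      rw [hap, hap]
      by_cases hk : k = i
      · simp [hk, hc.ne']
      · simp [hk]

theorem bijOn_coordStretch_box (i : Fin n) {a b c d : ℝ} (ha : 0 < a) (hb : 0 < b)
    (hc : 0 ≤ c) (hc1 : c ≤ 1) (hd : a * c + b * (1 - c) = d) :
    BijOn (coordStretch i a b c) (box i 1) (box i d) ∧
      InvOn (coordStretch i a⁻¹ b⁻¹ (a * c)) (coordStretch i a b c) (box i 1) (box i d) := by
  have h1 : ∀ x, coordStretch i a⁻¹ b⁻¹ (a * c) (coordStretch i a b c x) = x :=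
    coordStretch_coordStretch ha hb i c
  have h2 : ∀ x, coordStretch i a b c (coordStretch i a⁻¹ b⁻¹ (a * c) x) = x := by
    have := coordStretch_coordStretch (inv_pos.2 ha) (inv_pos.2 hb) i (a * c)
    simpa [ha.ne'] using this
  have hmem : ∀ x, coordStretch i a b c x ∈ box i d ↔ x ∈ box i 1 := by
    intro x
    refine forall_congr' fun k => ?_
    by_cases hk : k = i
    · subst hk
      -- The end points 0 and 1 go to 0 and `d`, so strict monotonicity matches the two intervals.
      have e0 : stretch a b c 0 = 0 := by rw [stretch_of_le hc, mul_zero]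
      have e1 : stretch a b c 1 = d := by rw [stretch_of_ge hc1, hd]
      rw [coordStretch_apply_self, if_pos rfl, if_pos rfl, mem_Ioo, mem_Ioo]
      nth_rewrite 1 [← e0]
      rw [← e1, (stretch_strictMono ha hb c).lt_iff_lt, (stretch_strictMono ha hb c).lt_iff_lt]
    · rw [coordStretch_apply_of_ne hk, if_neg hk, if_neg hk]
  have hinv : InvOn (coordStretch i a⁻¹ b⁻¹ (a * c)) (coordStretch i a b c) (box i 1) (box i d) :=
    ⟨fun x _ => h1 x, fun x _ => h2 x⟩
  refine ⟨hinv.bijOn (fun x hx => (hmem x).2 hx) fun x hx => ?_, hinv⟩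
  rw [← hmem, h2]
  exact hx

theorem isOrientationPreservingInvertible_coordStretch (p : ℝ) (i : Fin n) {a b c d : ℝ}
    (ha : 0 < a) (hb : 0 < b) (hc : 0 ≤ c) (hc1 : c ≤ 1) (hd : a * c + b * (1 - c) = d) :
    IsOrientationPreservingInvertible p (box i 1) (box i d) (coordStretch i a b c)
      fun x => dilation i (if x i < c then a else b) := by
  obtain ⟨K, hK⟩ := exists_lipschitzWith_coordStretch i a b c
  obtain ⟨K', hK'⟩ := exists_lipschitzWith_coordStretch i a⁻¹ b⁻¹ (a * c)
  obtain ⟨hbij, hinv⟩ := bijOn_coordStretch_box i ha hb hc hc1 hd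
  refine isOrientationPreservingInvertible_of_lipschitzWith p (isOpen_box i 1).measurableSet
    (isOpen_box i d).measurableSet (isBounded_box i 1) (isBounded_box i d) hK hK' hbij hinv
    (ae_restrict_of_ae ((ae_apply_ne i c).mono fun x hx => hasFDerivAt_coordStretch hx))
    (ae_restrict_of_ae ((ae_apply_ne i (a * c)).mono fun x hx => hasFDerivAt_coordStretch hx))
    (Filter.Eventually.of_forall fun x => ?_)
  rw [det_dilation]
  split_ifs <;> assumption

theorem extAverage_box_ite (i : Fin n) {c : ℝ} (hc : 0 ≤ c) (hc1 : c ≤ 1) (u v : ℝ) :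
    extAverage (box i 1) (fun x => if x i < c then u else v) = ((c * u + (1 - c) * v : ℝ) : EReal)
      := by
  have hfin : IsFiniteMeasure (volume.restrict (box i 1)) :=
    isFiniteMeasure_restrict.2 (isBounded_box i 1).measure_lt_top.ne
  have h1 := volume_real_box i zero_le_one
  have h0 : volume (box i 1) ≠ 0 := fun h => by
    rw [Measure.real, h] at h1; simp at h1
  -- Written as a constant plus an indicator, the integral reduces to the volume of the part of the
  -- cube below `c`, which is `box i c`.
  have hf : (fun x : EuclideanSpace ℝ (Fin n) => if x i < c then u else v) =
      fun x => {x : EuclideanSpace ℝ (Fin n) | x i < c}.indicator (fun _ => u - v) x + v := by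
    ext x
    by_cases hx : x i < c
    · rw [if_pos hx, indicator_of_mem (by exact hx)]; ring
    · rw [if_neg hx, indicator_of_notMem (by exact hx)]; ring
  have hm : MeasurableSet {x : EuclideanSpace ℝ (Fin n) | x i < c} :=
    (isOpen_lt (EuclideanSpace.proj (𝕜 := ℝ) i).continuous continuous_const).measurableSet
  have hi : Integrable ({x : EuclideanSpace ℝ (Fin n) | x i < c}.indicator fun _ => u - v)
      (volume.restrict (box i 1)) := (integrable_const _).indicator hm
  have hbox : {x : EuclideanSpace ℝ (Fin n) | x i < c} ∩ box i 1 = box i c := by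
    ext x
    constructor
    · rintro ⟨hx, hx1⟩ k
      by_cases hk : k = i
      · subst hk
        simpa using ⟨(hx1 k).1, hx⟩
      · simpa [hk] using hx1 k
    · intro hx
      have hxi := hx i
      simp only [if_true] at hxi
      refine ⟨hxi.2, fun k => ?_⟩
      by_cases hk : k = i
      · subst hk
        simpa using ⟨hxi.1, hxi.2.trans_le hc1⟩
      · simpa [hk] using hx k
  have hi' : IntegrableOn (fun x => {x : EuclideanSpace ℝ (Fin n) | x i < c}.indicator
      (fun _ => u - v) x + v) (box i 1) := hi.add (integrable_const v)
  rw [hf, extAverage_eq h0 hi', setAverage_eq, h1,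
    integral_add hi (integrable_const v), integral_indicator hm,
    Measure.restrict_restrict hm, hbox, setIntegral_const, setIntegral_const, volume_real_box i hc,
    h1]
  congr 1
  simp only [smul_eq_mul]
  ring

/-- The coordinate stretch with slopes `a` and `b` has the same image of the cube as the dilation by
the mean slope c a + (1 - c) b, and its gradient is one of two dilations on volume fractions c and 1
- c. -/
theorem IsBelowAverages.convexOn {p : ℝ} {Ψ : Matrix (Fin n) (Fin n) ℝ → ℝ}
    (h : IsBelowAverages p Ψ) (i : Fin n) : ConvexOn ℝ (Ioi 0) fun d => Ψ (dilation i d) := by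
  refine ⟨convex_Ioi 0, fun a ha b hb c c' hc hc' hcc => ?_⟩
  rw [mem_Ioi] at ha hb
  obtain rfl : c' = 1 - c := by linarith
  simp only [smul_eq_mul]
  have hd : 0 < c * a + (1 - c) * b := convex_Ioi (0 : ℝ) ha hb hc hc' hcc
  have h1 := isOrientationPreservingInvertible_coordStretch p i ha hb hc (by linarith)
    (d := c * a + (1 - c) * b) (by ring)
  rw [← image_dilation_box i hd] at h1
  have h2 := h _ _ _ _ (isBoundedLipschitzDomain_box i one_pos) (by rwa [det_dilation]) h1
  have h3 : (fun x : EuclideanSpace ℝ (Fin n) => Ψ (dilation i (if x i < c then a else b))) =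
      fun x => if x i < c then Ψ (dilation i a) else Ψ (dilation i b) := by
    ext x; split_ifs <;> rfl
  rwa [h3, extAverage_box_ite i hc (by linarith), EReal.coe_le_coe_iff] at h2

end Box

theorem theorem2 (n : ℕ) (hn : 1 ≤ n) (p : ℝ) (hp : (n : ℝ) < p)
    (Ψ : Matrix (Fin n) (Fin n) ℝ → ℝ) :
    (∀ (Ω : Set (EuclideanSpace ℝ (Fin n))) (M : Matrix (Fin n) (Fin n) ℝ)
        (y : EuclideanSpace ℝ (Fin n) → EuclideanSpace ℝ (Fin n))
        (F : EuclideanSpace ℝ (Fin n) → Matrix (Fin n) (Fin n) ℝ),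
        IsBoundedLipschitzDomain Ω → 0 < M.det →
        IsOrientationPreservingInvertible p Ω (Matrix.toEuclideanLin M '' Ω) y F →
        (Ψ M : EReal) ≤ extAverage Ω (fun x => Ψ (F x))) ↔
      ∃ H : ℝ → ℝ, ConvexOn ℝ (Set.Ioi 0) H ∧
        ∀ A : Matrix (Fin n) (Fin n) ℝ, 0 < A.det → Ψ A = H A.det := by
  constructor
  · intro h
    have hb : IsBelowAverages p Ψ := h
    let i : Fin n := ⟨0, hn⟩
    exact ⟨fun d => Ψ (dilation i d), hb.convexOn i, fun A hA =>
      hb.eq_of_det_eq (by rwa [det_dilation]) (det_dilation i _).symm⟩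
  · rintro ⟨H, hH, hΨ⟩ Ω M y F hΩ hM hy
    -- Together with n < p this gives p > 1, as Hölder's inequality requires.
    have h1 : (1 : ℝ) ≤ n := by exact_mod_cast hn
    exact hy.le_extAverage (h1.trans_lt hp) hp hΩ hM hH hΨ
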